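/- Fix an integer $k\ge 0$. A Boolean $k$-CSP instance $\Phi$ consists of finitely many variables and a finite collection of clauses; each clause is a predicate $f:\{0,1\}^k\to\{0,1\}$ applied to an ordered tuple of $k$ distinct variables. $\Phi$ is simple if its clauses are pairwise distinct. The value $val(\Phi)$ is the maximum over all assignments of $0/1$ values to the variables of the fraction of clauses that are satisfied (an instance without clauses has value $1$). For $R\ge 1$, an $R$-blowup of $\Phi$ is an instance in which each variable $x$ of $\Phi$ is replaced by $R$ copies, and each clause of $\Phi$ by the $R^k$ clauses obtained by replacing each of its variables by one of the copies of that variable, in all possible ways. For $p\in[0,1]$, the variable percolation $\Psi^v_p$ of an instance $\Psi$ is the random instance whose variable set $S$ contains each variable of $\Psi$ independently with probability $p$ and whose clauses are all clauses of $\Psi$ all of whose variables lie in $S$. Theorem. Let $\varepsilon,\delta>0$ be constants. There are a polynomial-time computable map $\Phi\mapsto\Psi$ on Boolean $k$-CSP instances, a function $R:\mathbb N\to\{1,2,\dots\}$ and a function $\eta:\mathbb N\to\mathbb R$ with $\eta(n)\to 0$ as $n\to\infty$ such that, for every simple instance $\Phi$ with $N$ variables, $\Psi$ is an $R(N)$-blowup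 of $\Phi$, $\Psi$ is simple, the predicates occurring in $\Psi$ are exactly those occurring in $\Phi$, $val(\Psi)=val(\Phi)$, and, with $n$ the number of variables of $\Psi$, the following holds for every $p\in[0,1]$ with $p>\frac{1}{n^{1-\delta}}$. 1. If $val(\Phi)=1$, then $val(\Psi^v_p)=1$ with probability $1$. 2. If $val(\Phi)<1$, then $|val(\Psi^v_p)-val(\Phi)|<\varepsilon$ with probability at least $1-\eta(n)$ (that is, with high probability as $n\to\infty$, uniformly in $\Phi$ and $p$). -/

import Mathlib

/-- `k`-ary Boolean predicates `{0,1}^k → {0,1}`. -/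
abbrev BoolPred (k : ℕ) : Type := (Fin k → Bool) → Bool

/-- A clause: a `k`-ary predicate applied to an ordered tuple of `k` distinct variables from `V`. -/
@[ext] structure CSPClause (k : ℕ) (V : Type*) where
  pred : BoolPred k
  vars : Fin k ↪ V

/-- A (finite, unweighted) formula over the variable set `V`: a finite collection `C₁, …, C_m` of
clauses. -/
@[ext] structure CSPFormula (k : ℕ) (V : Type*) where
  clauses : List (CSPClause k V)

namespace CSPClause

variable {k : ℕ} {V : Type*}

/-- The truth value of the clause under the assignment `σ`. -/
def sat (C : CSPClause k V) (σ : V → Bool) : Bool := C.pred (fun i => σ (C.vars i))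

open scoped Classical in
/-- The clause, seen over the variable set `S`, if all its variables lie in `S`. -/
noncomputable def restrict (S : Set V) (C : CSPClause k V) : Option (CSPClause k S) :=
  if h : ∀ i, C.vars i ∈ S then
    some ⟨C.pred, ⟨fun i => ⟨C.vars i, h i⟩,
      fun _ _ hij => C.vars.injective (congrArg Subtype.val hij)⟩⟩
  else none

end CSPClause

namespace CSPFormula

variable {k : ℕ} {V : Type*}

/-- All clauses of the formula are distinct. -/
def Simple (φ : CSPFormula k V) : Prop := φ.clauses.Nodup

/-- The set of predicates that occur in the formula. -/
def preds (φ : CSPFormula k V) : Set (BoolPred k) := {f | ∃ C ∈ φ.clauses, C.pred = f}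

/-- The fraction of clauses satisfied by `σ`; a formula without clauses is (vacuously) satisfied
by every assignment and has value `1`. -/
noncomputable def valAt (φ : CSPFormula k V) (σ : V → Bool) : ℝ :=
  if φ.clauses = [] then 1
  else (φ.clauses.countP (fun C => C.sat σ) : ℝ) / (φ.clauses.length : ℝ)

/-- The value of a formula: the maximum over all assignments of the fraction of satisfied
clauses. -/
noncomputable def val (φ : CSPFormula k V) : ℝ := ⨆ σ : V → Bool, φ.valAt σ

/-- The formula with variable set `S` consisting of all clauses all of whose variables are
in `S`. -/
noncomputable def induce (φ : CSPFormula k V) (S : Set V) : CSPFormula k S :=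
  ⟨φ.clauses.filterMap (CSPClause.restrict S)⟩

end CSPFormula

/-- An instance of Boolean `k`-CSP: a formula over the variables `x_0, …, x_{n-1}`. -/
structure CSPInstance (k : ℕ) where
  numVars : ℕ
  formula : CSPFormula k (Fin numVars)

/-- The (finite) alphabet in which instances are written: a tick, a separator, and one symbol for
each of the `2^(2^k)` predicates. -/
inductive CSPSymbol (k : ℕ) : Type
  | tick
  | sep
  | pred (f : BoolPred k)
  deriving DecidableEq, Fintype

namespace CSPInstance

variable {k : ℕ}

/-- A number in unary, closed by a separator. -/
def encodeNum (k a : ℕ) : List (CSPSymbol k) := List.replicate a .tick ++ [.sep]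

/-- A clause is written as its predicate, followed by the indices of its `k` variables. -/
def encodeClause {n : ℕ} (C : CSPClause k (Fin n)) : List (CSPSymbol k) :=
  .pred C.pred :: (List.finRange k).flatMap (fun i => encodeNum k (C.vars i))

/-- An instance is written as its number of variables, followed by its clauses. As each variable
counts for at least one unit of the size of an instance, unary indices change the size only
polynomially. -/
def encode (Φ : CSPInstance k) : List (CSPSymbol k) :=
  encodeNum k Φ.numVars ++ Φ.formula.clauses.flatMap encodeClause

theorem encodeNum_append_inj {a b : ℕ} {s t : List (CSPSymbol k)}
    (h : encodeNum k a ++ s = encodeNum k b ++ t) : a = b ∧ s = t := by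
  induction a generalizing b with
  | zero =>
    cases b with
    | zero => simpa [encodeNum] using h
    | succ b => simp [encodeNum, List.replicate_succ] at h
  | succ a ih =>
    cases b with
    | zero => simp [encodeNum, List.replicate_succ] at h
    | succ b =>
      have h' : encodeNum k a ++ s = encodeNum k b ++ t := by
        simpa [encodeNum, List.replicate_succ] using h
      exact ⟨congrArg Nat.succ (ih h').1, (ih h').2⟩

theorem encodeNums_append_inj {ι : Type*} (l : List ι) {v w : ι → ℕ} {s t : List (CSPSymbol k)}
    (h : l.flatMap (fun i => encodeNum k (v i)) ++ s
      = l.flatMap (fun i => encodeNum k (w i)) ++ t) :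
    (∀ i ∈ l, v i = w i) ∧ s = t := by
  induction l with
  | nil => simpa using h
  | cons i l ih =>
    simp only [List.flatMap_cons, List.append_assoc] at h
    obtain ⟨h1, h2⟩ := encodeNum_append_inj h
    obtain ⟨h3, h4⟩ := ih h2
    exact ⟨by simpa [h1] using h3, h4⟩

/-- Different instances are written differently. -/
theorem encode_injective : Function.Injective (encode (k := k)) := by
  rintro ⟨n, ⟨l⟩⟩ ⟨n', ⟨l'⟩⟩ h
  obtain ⟨h1, h2⟩ := encodeNum_append_inj h
  obtain rfl : n = n' := h1
  suffices l = l' by rw [this]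
  replace h2 : l.flatMap encodeClause = l'.flatMap encodeClause := h2
  clear h
  induction l generalizing l' with
  | nil => cases l' <;> simp_all [encodeClause]
  | cons C l ih =>
    cases l' with
    | nil => simp [encodeClause] at h2
    | cons D l' =>
      simp only [List.flatMap_cons, encodeClause, List.cons_append, List.cons.injEq,
        CSPSymbol.pred.injEq] at h2
      obtain ⟨h3, h4⟩ := encodeNums_append_inj _ h2.2
      have hCD : C = D := by
        ext1
        · exact h2.1
        · ext i
          exact h3 i (List.mem_finRange i)
      rw [hCD, ih l' h4]

/-- `Ψ` is the `R`-blowup of `Φ` (up to the numbering of its variables): each variable `x_v` of `Φ`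
is replaced by `R` copies `x_{v,j}`, and each clause of `Φ` by the cloud of all `R^k` clauses that
result from replacing each of its variables by one of the copies of that variable. -/
def IsBlowup (R : ℕ) (Φ Ψ : CSPInstance k) : Prop :=
  ∃ e : Fin Φ.numVars × Fin R ≃ Fin Ψ.numVars,
    ∀ C : CSPClause k (Fin Ψ.numVars), C ∈ Ψ.formula.clauses ↔
      ∃ D ∈ Φ.formula.clauses, ∃ j : Fin k → Fin R,
        C.pred = D.pred ∧ ∀ i, C.vars i = e (D.vars i, j i)

/-- The law of the random set of surviving variables: each variable of `Ψ` is kept independently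
with probability `p`. The variable percolation of `Ψ` is `Ψ.formula.induce S` for `S` distributed
according to this measure. -/
noncomputable def varPercolation (Ψ : CSPInstance k) (p : unitInterval) :
    MeasureTheory.Measure (Set (Fin Ψ.numVars)) :=
  ProbabilityTheory.setBernoulli Set.univ p

/-- A map on instances that a Turing machine computes in polynomial time. -/
def PolyTimeReduction (f : CSPInstance k → CSPInstance k) : Prop :=
  Nonempty (Turing.TM2ComputableInPolyTime (encode (k := k)) (encode (k := k)) f)

end CSPInstance

/-! Every variable is replaced by `R = (N + 1) ^ m` copies with `m ≥ 3 / δ`. Then `n = N * R ≤ (N +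
1) ^ (m + 1)`, so `p > n ^ (-(1 - δ))` gives, for `N > 0`, at least `p * R ≥ (N + 1) ^ ((m + 1) * δ
- 1) ≥ (N + 1) ^ 2` expected surviving copies of each variable. By Chebyshev's inequality a given
variable has its number of surviving copies outside `(1 ± γ) * p * R` with probability at most `1 /
(γ ^ 2 * p * R)`. The union bound over the `N` variables leaves a failure probability of at most `1
/ (γ ^ 2 * (N + 1))`, and `N + 1 ≥ (n + 1) ^ (1 / (m + 1))` turns this into a function of `n`
tending to `0`.

The rest is deterministic. A percolated blowup is a lift of the original formula (`IsLift`): its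
clauses are all lifts of the original ones to the surviving copies. Suppose that all fibers have
between `lo` and `hi` elements. Pulling back an optimal assignment loses at most a factor `(lo / hi)
^ k` (`IsLift.mul_val_le_val`). Conversely, let `σ` be an assignment of the lift and choose one copy
of each variable uniformly at random. Every choice yields an assignment of the original formula,
which satisfies at most a fraction `val` of its clauses, while each clause sees a uniformly random
one of its lifts. Averaging gives an upper bound with the factor `(hi / lo) ^ k`
(`IsLift.val_le_mul_val`). For `γ` small both factors are close to `1` (`IsLift.abs_val_sub_lt`);
equal fibers give equality of the values (`IsLift.val_eq_val`). A satisfying assignment pulls back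
to every lift, whatever the fibers are.

For polynomial time, the blowup is written as a program in a small language of stack programs with
unary counters. The language compiles to multi-stack machines, and the running time is tracked by
compositional rules (`Runs`). -/

/-! ### Structured stack programs and their compilation to Turing machines. -/

/-- Structured programs over a family of stacks indexed by `K` with entries in `A`. -/
inductive StackProg (K A : Type) : Type
  | skip : StackProg K A
  | push (k : K) (a : A) : StackProg K A
  | seq (P Q : StackProg K A) : StackProg K A
  /-- Pop entries off the stack `k`, running `body a` for each of them, until the stack is empty
  or an entry with `halt a` has been popped. -/
  | scan (k : K) (halt : A → Bool) (body : A → StackProg K A) : StackProg K A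

namespace StackProg

open Turing StateTransition

variable {K A : Type}

/-- The control points of a program. -/
def Label : StackProg K A → Type
  | skip => Unit
  | push _ _ => Unit
  | seq P Q => P.Label ⊕ Q.Label
  | scan _ _ body => Unit ⊕ (Σ a, (body a).Label)

/-- The control point at which a program starts. -/
def entry : (P : StackProg K A) → P.Label
  | skip => ()
  | push _ _ => ()
  | seq P _ => Sum.inl P.entry
  | scan _ _ _ => Sum.inl ()

instance finite_label [Finite A] (P : StackProg K A) : Finite P.Label := by
  induction P with
  | skip => exact inferInstanceAs (Finite Unit)
  | push k a => exact inferInstanceAs (Finite Unit)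
  | seq P Q hP hQ => exact inferInstanceAs (Finite (P.Label ⊕ Q.Label))
  | scan k halt body h => exact inferInstanceAs (Finite (Unit ⊕ (Σ a, (body a).Label)))

/-- The statements of a program, embedded by `ι` into a machine with labels `Λ`; the program is
left by a jump to `e`. -/
def code {Λ : Type} : (P : StackProg K A) → (P.Label → Λ) → Λ → P.Label →
    TM2.Stmt (fun _ : K => A) Λ (Option A)
  | skip, _, e, _ => .goto fun _ => e
  | push k a, _, e, _ => .push k (fun _ => a) (.goto fun _ => e)
  | seq P Q, ι, _, Sum.inl l => P.code (ι ∘ Sum.inl) (ι (Sum.inr Q.entry)) l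
  | seq _ Q, ι, e, Sum.inr l => Q.code (ι ∘ Sum.inr) e l
  | scan k halt body, ι, e, Sum.inl _ =>
      .pop k (fun _ o => o) (.goto fun o => match o with
        | none => e
        | some a => if halt a then e else ι (Sum.inr ⟨a, (body a).entry⟩))
  | scan _ _ body, ι, _, Sum.inr l =>
      (body l.1).code (fun l' => ι (Sum.inr ⟨l.1, l'⟩)) (ι (Sum.inl ())) l.2

variable [DecidableEq K]

/-- The machine `M` gets from the configuration `x` to the configuration `y` in at most `t`
steps. -/
def Reach {Λ : Type} (M : Λ → TM2.Stmt (fun _ : K => A) Λ (Option A)) (t : ℕ)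
    (x y : TM2.Cfg (fun _ : K => A) Λ (Option A)) : Prop :=
  Nonempty (EvalsToInTime (TM2.step M) x (some y) t)

section Reach

variable {Λ : Type} {M : Λ → TM2.Stmt (fun _ : K => A) Λ (Option A)}
  {x y z : TM2.Cfg (fun _ : K => A) Λ (Option A)} {t t' : ℕ}

theorem Reach.trans (h : Reach M t x y) (h' : Reach M t' y z) : Reach M (t + t') x z := by
  obtain ⟨h⟩ := h
  obtain ⟨h'⟩ := h'
  rw [add_comm]
  exact ⟨h.trans _ _ _ _ _ _ h'⟩

theorem Reach.mono (h : Reach M t x y) (htt : t ≤ t') : Reach M t' x y := by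
  obtain ⟨h⟩ := h
  exact ⟨⟨h.toEvalsTo, h.steps_le_m.trans htt⟩⟩

theorem Reach.single (h : TM2.step M x = some y) : Reach M 1 x y :=
  ⟨⟨⟨1, h⟩, le_rfl⟩⟩

end Reach

/-- Started with stacks `s`, the program terminates with stacks `s'` after at most `t` steps, in
whatever machine it is embedded. -/
def Runs (P : StackProg K A) (t : ℕ) (s s' : K → List A) : Prop :=
  -- Quantifying over all host machines makes the rule for `seq` a plain concatenation of runs. The
  -- local memory only carries a popped entry to the next jump, so its values before and after are
  -- irrelevant.
  ∀ (Λ : Type) (M : Λ → TM2.Stmt (fun _ : K => A) Λ (Option A)) (ι : P.Label → Λ) (e : Λ),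
    (∀ l, M (ι l) = P.code ι e l) →
      ∀ v, ∃ v', Reach M t ⟨some (ι P.entry), v, s⟩ ⟨some e, v', s'⟩

variable {P Q : StackProg K A} {t t' : ℕ} {s s' s'' : K → List A} {k : K} {a : A} {l : List A}
  {halt : A → Bool} {body : A → StackProg K A}

theorem Runs.mono (h : P.Runs t s s') (htt : t ≤ t') : P.Runs t' s s' := by
  intro Λ M ι e hM v
  obtain ⟨v', h⟩ := h Λ M ι e hM v
  exact ⟨v', h.mono htt⟩

theorem runs_skip : (skip : StackProg K A).Runs 1 s s := by
  intro Λ M ι e hM v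
  refine ⟨v, Reach.single ?_⟩
  simp [hM, code]

theorem runs_push : (push k a).Runs 1 s (Function.update s k (a :: s k)) := by
  intro Λ M ι e hM v
  refine ⟨v, Reach.single ?_⟩
  simp [hM, code]

theorem Runs.seq (h : P.Runs t s s') (h' : Q.Runs t' s' s'') :
    (P.seq Q).Runs (t + t') s s'' := by
  intro Λ M ι e hM v
  obtain ⟨v', h⟩ := h Λ M (ι ∘ Sum.inl) (ι (Sum.inr Q.entry)) (fun l => hM (Sum.inl l)) v
  obtain ⟨v'', h'⟩ := h' Λ M (ι ∘ Sum.inr) e (fun l => hM (Sum.inr l)) v'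
  exact ⟨v'', h.trans h'⟩

theorem runs_scan_nil (hs : s k = []) : (scan k halt body).Runs 1 s s := by
  intro Λ M ι e hM v
  refine ⟨none, Reach.single ?_⟩
  have h : Function.update s k ([] : List A) = s := by rw [← hs, Function.update_eq_self]
  have hM' := hM (Sum.inl ())
  simp only [entry, TM2.step, hM']
  simp [code, hs, h]

theorem runs_scan_stop (hs : s k = a :: l) (ha : halt a = true) :
    (scan k halt body).Runs 1 s (Function.update s k l) := by
  intro Λ M ι e hM v
  refine ⟨some a, Reach.single ?_⟩
  have hM' := hM (Sum.inl ())
  simp only [entry, TM2.step, hM']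
  simp [code, hs, ha]

theorem runs_scan_cons (hs : s k = a :: l) (ha : halt a = false)
    (h : (body a).Runs t (Function.update s k l) s')
    (h' : (scan k halt body).Runs t' s' s'') :
    (scan k halt body).Runs (1 + t + t') s s'' := by
  intro Λ M ι e hM v
  obtain ⟨v', h⟩ := h Λ M (fun l' => ι (Sum.inr ⟨a, l'⟩)) (ι (Sum.inl ()))
    (fun l => hM (Sum.inr ⟨a, l⟩)) (some a)
  obtain ⟨v'', h'⟩ := h' Λ M ι e hM v'
  refine ⟨v'', Reach.trans (Reach.trans (Reach.single ?_) h) h'⟩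
  have hM' := hM (Sum.inl ())
  simp only [entry, TM2.step, hM']
  simp [code, hs, ha]

/-- The Turing machine that runs a program, with input stack `k₀` and output stack `k₁`. -/
noncomputable def machine [Fintype K] [Fintype A] (P : StackProg K A) (k₀ k₁ : K) : FinTM2 :=
  letI : Fintype (Option P.Label) := Fintype.ofFinite _
  { K := K
    k₀ := k₀
    k₁ := k₁
    Γ := fun _ => A
    Λ := Option P.Label
    main := some P.entry
    σ := Option A
    initialState := none
    Γk₀Fin := inferInstance
    m := fun l => match l with
      | some l => P.code some none l
      -- A halting configuration must carry the initial memory value, so the memory is reset; this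
      -- costs the one extra step in `Runs.machine_outputs`.
      | none => .load (fun _ => none) .halt }

theorem Runs.machine_outputs [Fintype K] [Fintype A] {k₀ k₁ : K} {l l' : List A}
    (h : P.Runs t (Function.update (fun _ => []) k₀ l) (Function.update (fun _ => []) k₁ l')) :
    Nonempty (TM2OutputsInTime (P.machine k₀ k₁) l (some l') (t + 1)) := by
  obtain ⟨v, h⟩ := h _ (P.machine k₀ k₁).m some none (fun _ => rfl) none
  have h' := Reach.trans h (Reach.single (y := ⟨none, none, Function.update (fun _ => []) k₁ l'⟩)
    (by simp [machine]))
  -- `initList` and `haltList` transport the list along an equality of stack types; here all stacks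
  -- have the same type and the transport is trivial.
  have e : ∀ (k₀ : K) (l : List A) (k : K) (h : k = k₀ → List A = List A),
      (if hk : k = k₀ then (h hk).mpr l else []) = Function.update (fun _ => []) k₀ l k := by
    intro k₀ l k h
    by_cases hk : k = k₀
    · subst hk; simp
    · simp [hk]
  have e₀ : initList (P.machine k₀ k₁) l =
      ⟨some (some P.entry), none, Function.update (fun _ => []) k₀ l⟩ :=
    congrArg (TM2.Cfg.mk _ _) (funext fun k => e k₀ l k _)
  have e₁ : haltList (P.machine k₀ k₁) l' =
      ⟨none, none, Function.update (fun _ => []) k₁ l'⟩ :=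
    congrArg (TM2.Cfg.mk _ _) (funext fun k => e k₁ l' k _)
  change Nonempty (EvalsToInTime _ (initList (P.machine k₀ k₁) l)
    (some (haltList (P.machine k₀ k₁) l')) _)
  rw [e₀, e₁]
  exact h'

/-- A function computed by a program within polynomial time is computable by a Turing machine in
polynomial time. -/
theorem computableInPolyTime [Fintype K] [Fintype A] {α β : Type} {ea : α → List A}
    {eb : β → List A} {f : α → β} (P : StackProg K A) (k₀ k₁ : K) (time : Polynomial ℕ)
    (h : ∀ a, P.Runs (time.eval (ea a).length) (Function.update (fun _ => []) k₀ (ea a))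
      (Function.update (fun _ => []) k₁ (eb (f a)))) :
    Nonempty (TM2ComputableInPolyTime ea eb f) := by
  refine ⟨⟨⟨P.machine k₀ k₁, Equiv.refl A, Equiv.refl A⟩, time + 1, fun a => ?_⟩⟩
  have h' := (h a).machine_outputs
  have e : ∀ l : List A, l.map (Equiv.refl A).invFun = l := fun l => List.map_id l
  have key : ∀ l₀ l₁ : List A, l₀ = ea a → l₁ = eb (f a) →
      Nonempty (TM2OutputsInTime (P.machine k₀ k₁) l₀ (some l₁)
        ((time + 1).eval (ea a).length)) := by
    rintro _ _ rfl rfl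
    rw [Polynomial.eval_add, Polynomial.eval_one]
    exact h'
  exact (key _ _ (e _) (e _)).some

end StackProg

/-! ### Programs with unary counters. -/

/-- The stacks of a program with an input stack, an output stack and counters indexed by `C`. -/
inductive CounterStack (C : Type) : Type
  | inp
  | out
  | cnt (c : C)
  deriving DecidableEq, Fintype

namespace StackProg

open CounterStack

variable {k : ℕ} {C : Type}

/-- Counters hold their value in unary. -/
def store (i o : List (CSPSymbol k)) (n : C → ℕ) : CounterStack C → List (CSPSymbol k)
  | inp => i
  | out => o
  | cnt c => List.replicate (n c) .tick

/-- Increase a counter. -/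
def inc (c : C) : StackProg (CounterStack C) (CSPSymbol k) := push (cnt c) .tick

/-- Decrease a counter. -/
def dec (c : C) : StackProg (CounterStack C) (CSPSymbol k) :=
  scan (cnt c) (fun _ => true) fun _ => skip

/-- Count a counter down to zero, running `P` each time. -/
def drain (c : C) (P : StackProg (CounterStack C) (CSPSymbol k)) :
    StackProg (CounterStack C) (CSPSymbol k) :=
  scan (cnt c) (fun _ => false) fun _ => P

/-- Run `P` as often as the counter `c` says, with the help of the auxiliary counter `d`. -/
def rep (c d : C) (P : StackProg (CounterStack C) (CSPSymbol k)) :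
    StackProg (CounterStack C) (CSPSymbol k) :=
  (drain c ((inc d).seq P)).seq (drain d (inc c))

/-- Run `F x` for all entries `x` of a list. -/
def forEach {K A ι : Type} (l : List ι) (F : ι → StackProg K A) : StackProg K A :=
  l.foldr (fun x P => (F x).seq P) skip

/-- Write a symbol. -/
def emit (C : Type) (a : CSPSymbol k) : StackProg (CounterStack C) (CSPSymbol k) := push out a

variable [DecidableEq C] {i o : List (CSPSymbol k)} {n : C → ℕ}

theorem store_update_cnt (c : C) (x : ℕ) :
    Function.update (store i o n) (cnt c) (List.replicate x .tick) =
      store i o (Function.update n c x) := by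
  funext s
  rcases s with _ | _ | c'
  · simp [store]
  · simp [store]
  · by_cases h : c' = c
    · subst h; simp [store]
    · simp [store, h]

theorem store_update_inp (i' : List (CSPSymbol k)) :
    Function.update (store i o n) inp i' = store i' o n := by
  funext s
  rcases s with _ | _ | c' <;> simp [store]

theorem store_update_out (o' : List (CSPSymbol k)) :
    Function.update (store i o n) out o' = store i o' n := by
  funext s
  rcases s with _ | _ | c' <;> simp [store]

theorem runs_inc (c : C) : (inc c).Runs 1 (store i o n) (store i o (n + Pi.single c 1)) := by
  have h := runs_push (s := store i o n) (k := cnt c) (a := CSPSymbol.tick)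
  have e : CSPSymbol.tick :: store i o n (cnt c) = List.replicate (n c + 1) .tick := by
    simp [store, List.replicate_succ]
  have e' : n + Pi.single c 1 = Function.update n c (n c + 1) := by
    funext c'
    by_cases hc : c' = c
    · subst hc; simp
    · simp [hc]
  rw [e, store_update_cnt] at h
  rw [e']
  exact h

theorem runs_emit (a : CSPSymbol k) : (emit C a).Runs 1 (store i o n) (store i (a :: o) n) := by
  have h := runs_push (s := store i o n) (k := out) (a := a)
  rwa [store_update_out] at h

theorem runs_dec (c : C) :
    (dec c).Runs 1 (store i o (n + Pi.single c 1)) (store i o n) := by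
  have h := runs_scan_stop (s := store i o (n + Pi.single c 1)) (k := cnt c)
    (a := CSPSymbol.tick) (l := List.replicate (n c) .tick) (halt := fun _ => true)
    (body := fun _ => skip) (by simp [store, List.replicate_succ]) rfl
  have e' : Function.update (n + Pi.single c 1) c (n c) = n := by
    funext c'
    by_cases hc : c' = c
    · subst hc; simp
    · simp [hc]
  rw [store_update_cnt, e'] at h
  exact h

/-- `w t` and `u t` are the output and the counters after `t` rounds. The tick is popped before the
body runs, so during round `t` the counter already reads `b - (t + 1)`. -/
theorem runs_drain {c : C} {P : StackProg (CounterStack C) (CSPSymbol k)} {T : ℕ} (b : ℕ)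
    (w : ℕ → List (CSPSymbol k)) (u : ℕ → C → ℕ)
    (h : ∀ t < b, P.Runs T (store i (w t) (Function.update (u t) c (b - (t + 1))))
      (store i (w (t + 1)) (Function.update (u (t + 1)) c (b - (t + 1))))) :
    (drain c P).Runs (b * (T + 1) + 1) (store i (w 0) (Function.update (u 0) c b))
      (store i (w b) (Function.update (u b) c 0)) := by
  induction b generalizing w u with
  | zero => exact (runs_scan_nil (by simp [store])).mono (by omega)
  | succ b ih =>
    have h₀ := h 0 (by omega)
    have h₁ := ih (fun t => w (t + 1)) (fun t => u (t + 1)) (fun t ht => by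
      have := h (t + 1) (by omega)
      rwa [show b + 1 - (t + 1 + 1) = b - (t + 1) by omega] at this)
    refine (runs_scan_cons (a := CSPSymbol.tick) (l := List.replicate b .tick)
      (by simp [store, List.replicate_succ]) rfl ?_ h₁).mono ?_ (t := 1 + T + (b * (T + 1) + 1))
    · rw [store_update_cnt]
      simpa using h₀
    · rw [add_mul]; omega

/-- The first loop moves `c` to `d`, the second moves it back. In between both counters are in flux,
so the body must work for every `n'` that agrees with `n` away from `c` and `d`. -/
theorem runs_rep {c d : C} (hcd : c ≠ d) {P : StackProg (CounterStack C) (CSPSymbol k)} {T : ℕ}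
    (w : ℕ → List (CSPSymbol k)) (u : ℕ → C → ℕ) (hd : n d = 0)
    (huc : ∀ t, u t c = 0) (hud : ∀ t, u t d = 0)
    (h : ∀ t < n c, ∀ n' : C → ℕ, (∀ x, x ≠ c → x ≠ d → n' x = n x) →
      P.Runs T (store i (w t) (n' + u t)) (store i (w (t + 1)) (n' + u (t + 1)))) :
    (rep c d P).Runs (n c * (T + 4) + 2) (store i (w 0) (n + u 0))
      (store i (w (n c)) (n + u (n c))) := by
  have h₁ := runs_drain (i := i) (c := c) (P := (inc d).seq P) (T := 1 + T) (n c) w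
    (fun t => Function.update n d t + u t) (fun t ht => by
      have h' := h t ht (Function.update (Function.update n c (n c - (t + 1))) d (t + 1))
        (fun x hx hx' => by simp [hx, hx'])
      refine Runs.seq (s' := store i (w t)
        (Function.update (Function.update n c (n c - (t + 1))) d (t + 1) + u t)) ?_ ?_
      · convert runs_inc d using 2
        funext x
        by_cases hx : x = c
        · subst hx; simp [hcd, huc]
        · by_cases hx' : x = d
          · subst hx'; simp [hx, hud]
          · simp [hx, hx']
      · convert h' using 2
        funext x
        by_cases hx : x = c
        · subst hx; simp [hcd, huc]
        · by_cases hx' : x = d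
          · subst hx'; simp [hx, hud]
          · simp [hx, hx'])
  have h₂ := runs_drain (i := i) (c := d) (P := inc c) (T := 1) (n c) (fun _ => w (n c))
    (fun t => Function.update n c t + u (n c)) (fun t ht => by
      convert runs_inc c using 2
      funext x
      by_cases hx : x = c
      · subst hx; simp [hcd, huc]
      · by_cases hx' : x = d
        · subst hx'; simp [hx]
        · simp [hx, hx'])
  have h₃ := (h₁.seq (Q := drain d (inc c)) (s'' := (store i (w (n c)) (n + u (n c)))) (by
    convert h₂ using 2
    · funext x
      by_cases hx : x = c
      · subst hx; simp [hcd, huc]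
      · by_cases hx' : x = d
        · subst hx'; simp [hx, hud]
        · simp [hx, hx']
    · funext x
      by_cases hx : x = d
      · subst hx; simp [hd, hud]
      · simp [hx]))
  have e : Function.update (Function.update n d 0 + u 0) c (n c) = n + u 0 := by
    funext x
    by_cases hx : x = c
    · subst hx; simp [huc]
    · by_cases hx' : x = d
      · subst hx'; simp [hx, hd]
      · simp [hx, hx']
  rw [e] at h₃
  refine h₃.mono ?_
  have : n c * (T + 4) = n c * (1 + T + 1) + n c * (1 + 1) := by ring
  omega

end StackProg

/-! ### The program that computes blowups, and its running time. -/

namespace StackProg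

open CounterStack

section

variable {k : ℕ} {C : Type} [DecidableEq C] {i o : List (CSPSymbol k)} {n : C → ℕ}

theorem runs_rep_emit {c d : C} (hcd : c ≠ d) (hd : n d = 0) :
    (rep c d (emit C .tick)).Runs (n c * 5 + 2) (store i o n)
      (store i (List.replicate (n c) .tick ++ o) n) := by
  have h := runs_rep (i := i) (n := n) hcd (P := emit C .tick) (T := 1)
    (fun t => List.replicate t .tick ++ o) (fun _ => 0) hd (fun _ => rfl) (fun _ => rfl)
    (fun t _ n' _ => runs_emit _)
  simpa using h

theorem runs_rep_inc {c d e : C} (hcd : c ≠ d) (hec : e ≠ c) (hed : e ≠ d) (hd : n d = 0) :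
    (rep c d (inc e)).Runs (n c * 5 + 2) (store i o n)
      (store i o (n + Pi.single e (n c))) := by
  have h := runs_rep (i := i) (n := n) hcd (P := inc e) (T := 1)
    (fun _ => o) (fun t => Pi.single e t) hd (fun _ => by simp [hec.symm])
    (fun _ => by simp [hed.symm])
    (fun t _ n' _ => by
      have := runs_inc (i := i) (o := o) (n := n' + Pi.single e t) e
      rwa [add_assoc, ← Pi.single_add] at this)
  simpa using h

theorem runs_rep_dec {c d e : C} (hcd : c ≠ d) (hec : e ≠ c) (hed : e ≠ d) (hd : n d = 0) :
    (rep c d (dec e)).Runs (n c * 5 + 2) (store i o (n + Pi.single e (n c)))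
      (store i o n) := by
  have h := runs_rep (i := i) (n := n) hcd (P := dec e) (T := 1)
    (fun _ => o) (fun t => Pi.single e (n c - t)) hd (fun _ => by simp [hec.symm])
    (fun _ => by simp [hed.symm])
    (fun t ht n' _ => by
      have := runs_dec (i := i) (o := o) (n := n' + Pi.single e (n c - (t + 1))) e
      rwa [add_assoc, ← Pi.single_add, show n c - (t + 1) + 1 = n c - t by omega] at this)
  simpa using h

theorem runs_clear (c : C) :
    (drain c skip).Runs (n c * 2 + 1) (store i o n) (store i o (Function.update n c 0)) := by
  have h := runs_drain (i := i) (c := c) (P := skip) (T := 1) (n c) (fun _ => o) (fun _ => n)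
    (fun _ _ => runs_skip)
  simpa using h

theorem runs_forEach_inc {ι : Type} (g : ι → C) (l : List ι) :
    (forEach l fun x => inc (g x)).Runs (l.length + 1) (store i o n)
      (store i o (n + (l.map fun x => Pi.single (g x) 1).sum)) := by
  induction l generalizing n with
  | nil =>
    simp only [List.map_nil, List.sum_nil, add_zero]
    exact runs_skip
  | cons x l ih =>
    have h := (runs_inc (i := i) (o := o) (n := n) (g x)).seq ih
    rw [add_assoc] at h
    refine h.mono ?_
    simp; omega

end

/-- The counters of the program that computes blowups. -/
inductive BlowupCounter (k m : ℕ) : Type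
  | size
  -- Nested loops cannot share a counter, since `rep` empties it while running. Hence each nesting
  -- level has its own copy, with its own auxiliary counter.
  | pow (j : Fin m)
  | powAux (j : Fin m)
  | radix
  | radixAux
  | rad (i : Fin k)
  | radAux (i : Fin k)
  | idx (i : Fin k)
  | tmp
  deriving DecidableEq, Fintype

open BlowupCounter

/-- Programs computing blowups. -/
abbrev BlowupProg (k m : ℕ) : Type := StackProg (CounterStack (BlowupCounter k m)) (CSPSymbol k)

variable {k m : ℕ}

/-- Write a clause with the given predicate and with the variables held by the counters `idx`. -/
def emitClause (m : ℕ) (f : BoolPred k) : BlowupProg k m :=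
  -- The output is a stack, so every clause is written from its last symbol to its first.
  (forEach (List.finRange k).reverse fun i =>
    (emit _ .sep).seq (rep (idx i) tmp (emit _ .tick))).seq (emit _ (.pred f))

/-- Write the clauses that result from adding numbers below the radix to the counters `idx i`, for
`i` in the list. -/
def emitCloud (m : ℕ) (f : BoolPred k) : List (Fin k) → BlowupProg k m
  | [] => emitClause m f
  | i :: l => (rep (rad i) (radAux i) ((emitCloud m f l).seq (inc (idx i)))).seq
      -- The loop has raised `idx i` by the radix; this restores it for the enclosing loop.
      (rep (rad i) (radAux i) (dec (idx i)))

/-- Read a number and add its product with the radix to the counter `idx i`. -/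
def readIdx (m : ℕ) (i : Fin k) : BlowupProg k m :=
  scan inp (fun a => decide (a = .sep)) fun _ => rep radix radixAux (inc (idx i))

/-- Read the variables of a clause with predicate `f` and write the clauses of its cloud. -/
def blowupClause (m : ℕ) (f : BoolPred k) : BlowupProg k m :=
  (forEach (List.finRange k) (readIdx m)).seq <|
    (emitCloud m f (List.finRange k)).seq <|
      forEach (List.finRange k) fun i => drain (idx i) skip

/-- Read clauses and write the clauses of their clouds. -/
def blowupClauses (k m : ℕ) : BlowupProg k m :=
  scan inp (fun _ => false) fun a => match a with
    | .pred f => blowupClause m f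
    | _ => skip

/-- Read the number of variables. -/
def readSize (k m : ℕ) : BlowupProg k m :=
  scan inp (fun a => decide (a = .sep)) fun _ =>
    (inc size).seq (forEach (List.finRange m) fun j => inc (pow j))

/-- Add the product of the counters `pow j`, for `j` in the list, to the radix counters. -/
def computeRadix (k : ℕ) : List (Fin m) → BlowupProg k m
  | [] => (inc radix).seq (forEach (List.finRange k) fun i => inc (rad i))
  | j :: l => rep (pow j) (powAux j) (computeRadix k l)

/-- Write the number of variables, and clear the counters. -/
def finish (k m : ℕ) : BlowupProg k m :=
  -- The separator goes below the ticks, as the output grows at the front. The counters are cleared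
  -- because only the output stack may be nonempty when the machine halts.
  (emit _ .sep).seq <| (drain size (rep radix radixAux (emit _ .tick))).seq <|
    (drain radix skip).seq <| (forEach (List.finRange m) fun j => drain (pow j) skip).seq <|
      forEach (List.finRange k) fun i => drain (rad i) skip

/-- The program that computes the `(N + 1) ^ m`-blowup of an instance with `N` variables. -/
def blowupProg (k m : ℕ) : BlowupProg k m :=
  (readSize k m).seq <| (forEach (List.finRange m) fun j => inc (pow j)).seq <|
    (computeRadix k (List.finRange m)).seq <| (blowupClauses k m).seq (finish k m)

/-- The tuples that arise from `a` by adding numbers below `R` to the entries in the list. -/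
def shifts {ι : Type} [DecidableEq ι] (R : ℕ) : List ι → (ι → ℕ) → List (ι → ℕ)
  | [], a => [a]
  -- The clauses written last end up in front, hence the decreasing order of `j`.
  | i :: l, a => (List.range R).reverse.flatMap fun j =>
      shifts R l (Function.update a i (a i + j))

/-- A clause as written in the encoding of an instance. -/
def encodeRaw (f : BoolPred k) (a : Fin k → ℕ) : List (CSPSymbol k) :=
  .pred f :: (List.finRange k).flatMap fun i => CSPInstance.encodeNum k (a i)

/-- The time that `emitCloud` takes. -/
def cloudTime (k R B : ℕ) : ℕ → ℕ
  | 0 => k * (5 * B + 3) + 2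
  | l + 1 => R * (cloudTime k R B l + 10) + 4

/-- The time that `computeRadix` takes. -/
def radixTime (k b : ℕ) : ℕ → ℕ
  | 0 => k + 2
  | l + 1 => b * (radixTime k b l + 4) + 2

variable {i o : List (CSPSymbol k)} {n : BlowupCounter k m → ℕ}

theorem runs_emitClause {f : BoolPred k} {B : ℕ} (hB : ∀ i, n (idx i) ≤ B) (htmp : n tmp = 0) :
    (emitClause m f).Runs (k * (5 * B + 3) + 2) (store i o n)
      (store i (encodeRaw f (fun i => n (idx i)) ++ o) n) := by
  have key : ∀ (l : List (Fin k)) (o : List (CSPSymbol k)),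
      (forEach l fun i => (emit _ .sep).seq (rep (idx i) tmp (emit _ .tick))).Runs
        (l.length * (5 * B + 3) + 1) (store i o n)
        (store i ((l.reverse.flatMap fun i => CSPInstance.encodeNum k (n (idx i))) ++ o) n) := by
    intro l
    induction l with
    | nil =>
      intro o
      simp only [List.length_nil, zero_mul, zero_add]
      exact runs_skip
    | cons x l ih =>
      intro o
      have h := ((runs_emit (i := i) (o := o) (n := n) .sep).seq
        (runs_rep_emit (c := idx x) (d := tmp) (by simp) htmp)).seq (ih _)
      have e : l.reverse.flatMap (fun i => CSPInstance.encodeNum k (n (idx i))) ++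
          (List.replicate (n (idx x)) CSPSymbol.tick ++ .sep :: o) =
          (x :: l).reverse.flatMap (fun i => CSPInstance.encodeNum k (n (idx i))) ++ o := by
        simp [CSPInstance.encodeNum]
      rw [e] at h
      refine h.mono ?_
      have := hB x
      rw [List.length_cons, add_mul]
      omega
  have h := (key (List.finRange k).reverse o).seq (runs_emit (.pred f))
  rw [List.reverse_reverse, List.length_reverse, List.length_finRange] at h
  exact h

/-- Induction on the nesting depth: in round `t` of the outer loop `idx x` has been raised by `t`,
and the inner loops write the shifts of the raised tuple in front of the earlier output. -/
theorem runs_emitCloud {f : BoolPred k} {R B : ℕ} (l : List (Fin k)) (hl : l.Nodup)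
    (hR : ∀ i ∈ l, n (rad i) = R) (hA : ∀ i ∈ l, n (radAux i) = 0)
    (hB : ∀ i ∈ l, n (idx i) + R ≤ B) (hB' : ∀ i ∉ l, n (idx i) ≤ B) (htmp : n tmp = 0) :
    (emitCloud m f l).Runs (cloudTime k R B l.length) (store i o n)
      (store i ((shifts R l (fun i => n (idx i))).flatMap (encodeRaw f) ++ o) n) := by
  induction l generalizing n o with
  | nil =>
    have h := runs_emitClause (m := m) (i := i) (o := o) (f := f)
      (fun i => hB' i (by simp)) htmp
    simpa [shifts, emitCloud, cloudTime] using h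
  | cons x l ih =>
    obtain ⟨hx, hl⟩ := List.nodup_cons.1 hl
    have hRx := hR x (by simp)
    have hAx := hA x (by simp)
    have h₁ := runs_rep (i := i) (n := n) (c := rad x) (d := radAux x) (by simp)
      (P := (emitCloud m f l).seq (inc (idx x))) (T := cloudTime k R B l.length + 1)
      (fun t => ((List.range t).reverse.flatMap fun j =>
        shifts R l (Function.update (fun i => n (idx i)) x (n (idx x) + j))).flatMap
          (encodeRaw f) ++ o)
      (fun t => Pi.single (idx x) t) hAx (fun t => by simp) (fun t => by simp)
      (fun t ht n' hn' => by
        have ht' : t < R := hRx ▸ ht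
        have e : (fun i => (n' + Pi.single (idx x) t : BlowupCounter k m → ℕ) (idx i)) =
            Function.update (fun i => n (idx i)) x (n (idx x) + t) := by
          funext y
          by_cases hy : y = x
          · subst hy; simp [hn']
          · simp [hy, hn']
        have hne : ∀ y ∈ l, y ≠ x := fun y hy h => hx (h ▸ hy)
        have h := (ih (n := n' + Pi.single (idx x) t)
          (o := ((List.range t).reverse.flatMap fun j =>
            shifts R l (Function.update (fun i => n (idx i)) x (n (idx x) + j))).flatMap
              (encodeRaw f) ++ o) hl
          (fun y hy => by
            have := hR y (by simp [hy])
            simp [hn', hne y hy, this])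
          (fun y hy => by
            have := hA y (by simp [hy])
            simp [hn', hne y hy, this])
          (fun y hy => by
            have := hB y (by simp [hy])
            simpa [hn', hne y hy] using this)
          (fun y hy => by
            by_cases hyx : y = x
            · subst hyx
              have := hB y (by simp)
              simp [hn']
              omega
            · have := hB' y (by simp [hy, hyx])
              simpa [hn', hyx] using this)
          (by simp [hn', htmp])).seq (runs_inc (idx x))
        rw [e, add_assoc, ← Pi.single_add] at h
        simpa [List.range_succ] using h)
    have h₂ := runs_rep_dec (i := i) (n := n) (c := rad x) (d := radAux x) (e := idx x)
      (o := ((List.range R).reverse.flatMap fun j =>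
        shifts R l (Function.update (fun i => n (idx i)) x (n (idx x) + j))).flatMap
          (encodeRaw f) ++ o) (by simp) (by simp) (by simp) hAx
    rw [hRx] at h₁ h₂
    have h := h₁.seq h₂
    simp only [List.range_zero, List.reverse_nil, List.flatMap_nil, List.nil_append,
      Pi.single_zero, add_zero] at h
    refine h.mono (le_of_eq ?_)
    rw [List.length_cons, cloudTime]
    ring

/-- Each of the nested loops multiplies the number of runs of the innermost increment by `b`, which
gives `b ^ l.length` in total. -/
theorem runs_computeRadix {b : ℕ} (l : List (Fin m)) (hl : l.Nodup)
    (hb : ∀ j ∈ l, n (pow j) = b) (hA : ∀ j ∈ l, n (powAux j) = 0) :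
    (computeRadix k l).Runs (radixTime k b l.length) (store i o n)
      (store i o (n + b ^ l.length •
        (Pi.single radix 1 + ∑ i, Pi.single (rad i) 1))) := by
  induction l generalizing n with
  | nil =>
    have h := (runs_inc (i := i) (o := o) (n := n) radix).seq
      (runs_forEach_inc rad (List.finRange k))
    rw [List.length_finRange, add_assoc, ← Fin.sum_univ_def] at h
    simp only [List.length_nil, pow_zero, one_smul]
    refine Runs.mono (P := computeRadix k []) h ?_
    rw [radixTime]
    omega
  | cons x l ih =>
    obtain ⟨hx, hl⟩ := List.nodup_cons.1 hl
    have hne : ∀ y ∈ l, y ≠ x := fun y hy h => hx (h ▸ hy)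
    set u : BlowupCounter k m → ℕ :=
      Pi.single radix 1 + ∑ i, Pi.single (rad i) 1 with hu
    have hu' : ∀ j, u (pow j) = 0 ∧ u (powAux j) = 0 := fun j => by
      simp [hu]
    have h := runs_rep (i := i) (n := n) (c := pow x) (d := powAux x) (by simp)
      (P := computeRadix k l) (T := radixTime k b l.length) (fun _ => o)
      (fun t => t • b ^ l.length • u) (hA x (by simp)) (fun t => by simp [hu'])
      (fun t => by simp [hu'])
      (fun t ht n' hn' => by
        have h := ih (n := n' + t • b ^ l.length • u) hl
          (fun y hy => by simp [hu', hn', hne y hy, hb y (by simp [hy])])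
          (fun y hy => by simp [hu', hn', hne y hy, hA y (by simp [hy])])
        rwa [add_assoc, ← succ_nsmul] at h)
    rw [hb x (by simp)] at h
    simp only [smul_smul, zero_mul, zero_smul, add_zero] at h
    rw [← pow_succ'] at h
    exact h

end StackProg

namespace StackProg

open CounterStack BlowupCounter

variable {k m : ℕ} {i o : List (CSPSymbol k)} {N b R : ℕ} {a : Fin k → ℕ}

/-- The values of the counters between the phases of `blowupProg`. -/
def counters (m N b R : ℕ) (a : Fin k → ℕ) : BlowupCounter k m → ℕ
  | size => N
  | pow _ => b
  | powAux _ => 0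
  | radix => R
  | radixAux => 0
  | rad _ => R
  | radAux _ => 0
  | idx x => a x
  | tmp => 0

theorem counters_zero : counters m 0 0 0 (0 : Fin k → ℕ) = 0 := by
  funext c
  cases c <;> rfl

/-- The time that reading a number below `N` takes. -/
def readTime (N R : ℕ) : ℕ := N * (5 * R + 3) + 1

/-- The time that `blowupClause` takes. -/
def clauseTime (k N R : ℕ) : ℕ :=
  k * readTime N R + 1 + (cloudTime k R (N * R) k + (k * (N * R * 2 + 1) + 1))

/-- Each tick read adds the radix, so the index `v` is turned into `v * R`, the number of the first
copy of the variable `v`. -/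
theorem runs_readIdx (x : Fin k) (v : ℕ) :
    (readIdx m x).Runs (readTime v R)
      (store (CSPInstance.encodeNum k v ++ i) o (counters m N b R a))
      (store i o (counters m N b R (a + Pi.single x (v * R)))) := by
  induction v generalizing a with
  | zero =>
    have h := runs_scan_stop (s := store (.sep :: i) o (counters m N b R a)) (k := inp)
      (a := CSPSymbol.sep) (l := i) (halt := fun a => decide (a = .sep))
      (body := fun _ => rep radix radixAux (inc (idx x))) rfl (by simp)
    rw [store_update_inp] at h
    have e : a + Pi.single x (0 * R) = a := by simp
    rw [e, readTime]
    refine Runs.mono h ?_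
    omega
  | succ v ih =>
    have h₁ := runs_rep_inc (i := CSPInstance.encodeNum k v ++ i) (o := o)
      (n := counters m N b R a) (c := radix) (d := radixAux) (e := idx x)
      (by simp) (by simp) (by simp) rfl
    have e : counters m N b R a + Pi.single (idx x) (counters m N b R a radix) =
        counters m N b R (a + Pi.single x R) := by
      funext c
      cases c <;> simp [counters, Pi.single_apply]
    rw [e] at h₁
    have h₂ := ih (a := a + Pi.single x R)
    rw [add_assoc, ← Pi.single_add, show R + v * R = (v + 1) * R by ring] at h₂
    refine (runs_scan_cons (a := CSPSymbol.tick) (l := CSPInstance.encodeNum k v ++ i) ?_ ?_ ?_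
      h₂).mono (t := 1 + (counters m N b R a radix * 5 + 2) + readTime v R) ?_
    · simp [store, CSPInstance.encodeNum, List.replicate_succ]
    · simp
    · rw [store_update_inp]
      exact h₁
    · simp only [readTime, counters, add_mul]
      omega

theorem runs_forEach_readIdx {v : Fin k → ℕ} (hv : ∀ x, v x ≤ N) (l : List (Fin k)) :
    (forEach l (readIdx m)).Runs (l.length * readTime N R + 1)
      (store ((l.flatMap fun x => CSPInstance.encodeNum k (v x)) ++ i) o (counters m N b R a))
      (store i o (counters m N b R (a + (l.map fun x => Pi.single x (v x * R)).sum))) := by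
  induction l generalizing a with
  | nil =>
    simp only [List.length_nil, zero_mul, zero_add, List.flatMap_nil, List.nil_append,
      List.map_nil, List.sum_nil, add_zero]
    exact runs_skip
  | cons x l ih =>
    have h := (runs_readIdx (m := m) (N := N) (b := b) (R := R) (a := a) (o := o)
      (i := (l.flatMap fun x => CSPInstance.encodeNum k (v x)) ++ i) x (v x)).seq ih
    rw [add_assoc, ← List.append_assoc] at h
    refine Runs.mono (P := forEach (x :: l) (readIdx m)) h ?_
    have : readTime (v x) R ≤ readTime N R := by
      unfold readTime
      gcongr
      exact hv x
    rw [List.length_cons, add_mul]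
    omega

theorem runs_forEach_clear {C ι : Type} [DecidableEq C] {n : C → ℕ} {B : ℕ} (g : ι → C)
    (l : List ι) (hB : ∀ x, n (g x) ≤ B) :
    (forEach l fun x => drain (g x) skip).Runs (l.length * (B * 2 + 1) + 1) (store i o n)
      (store i o (fun c => open scoped Classical in if c ∈ l.map g then 0 else n c)) := by
  classical
  induction l generalizing n with
  | nil =>
    simp only [List.length_nil, zero_mul, zero_add, List.map_nil, List.not_mem_nil, if_false]
    exact runs_skip
  | cons x l ih =>
    have h := (runs_clear (i := i) (o := o) (n := n) (g x)).seq (ih (fun y => by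
      by_cases hy : g y = g x
      · simp [hy]
      · simpa [hy] using hB y))
    have e : (fun c => if c ∈ l.map g then 0 else Function.update n (g x) 0 c) =
        fun c => if c ∈ (x :: l).map g then 0 else n c := by
      funext c
      by_cases hc : c = g x
      · subst hc; simp
      · simp [hc]
    have e' : (fun c => open scoped Classical in
        if c ∈ l.map g then 0 else Function.update n (g x) 0 c) =
        fun c => open scoped Classical in if c ∈ (x :: l).map g then 0 else n c := by
      convert e
    rw [e'] at h
    refine Runs.mono (P := forEach (x :: l) fun x => drain (g x) skip) h ?_
    have := hB x
    rw [List.length_cons, add_mul]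
    omega

theorem runs_blowupClause (C : CSPClause k (Fin N)) :
    (blowupClause m C.pred).Runs (clauseTime k N R)
      (store (((List.finRange k).flatMap fun x => CSPInstance.encodeNum k (C.vars x)) ++ i) o
        (counters m N b R 0))
      (store i ((shifts R (List.finRange k) (fun x => C.vars x * R)).flatMap
        (encodeRaw C.pred) ++ o) (counters m N b R 0)) := by
  have h₁ := runs_forEach_readIdx (m := m) (b := b) (R := R) (a := 0) (i := i) (o := o)
    (v := fun x => C.vars x) (fun x => (C.vars x).2.le) (List.finRange k)
  have e : (0 : Fin k → ℕ) + ((List.finRange k).map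
      fun x => Pi.single x (((C.vars x : Fin N) : ℕ) * R)).sum = fun x => (C.vars x : ℕ) * R := by
    rw [zero_add, ← Fin.sum_univ_def, Finset.univ_sum_single]
  rw [e, List.length_finRange] at h₁
  have hle : ∀ x, (C.vars x : ℕ) * R + R ≤ N * R := fun x => by
    rw [← Nat.succ_mul]
    exact Nat.mul_le_mul_right _ (C.vars x).2
  have h₂ := runs_emitCloud (m := m) (i := i) (o := o) (f := C.pred) (R := R) (B := N * R)
    (n := counters m N b R fun x => (C.vars x : ℕ) * R) (List.finRange k)
    (List.nodup_finRange k) (fun _ _ => rfl) (fun _ _ => rfl) (fun x _ => hle x)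
    (fun x hx => absurd (List.mem_finRange x) hx) rfl
  have h₃ := runs_forEach_clear (i := i) (o := (shifts R (List.finRange k)
    (fun x => C.vars x * R)).flatMap (encodeRaw C.pred) ++ o)
    (n := counters m N b R fun x => (C.vars x : ℕ) * R) (B := N * R) idx (List.finRange k)
    (fun x => (Nat.le_add_right _ _).trans (hle x))
  have e₃ : (fun c => open scoped Classical in if c ∈ (List.finRange k).map idx then 0 else
      counters m N b R (fun x => (C.vars x : ℕ) * R) c) = counters m N b R 0 := by
    funext c
    cases c <;> simp [counters]
  rw [e₃] at h₃
  rw [List.length_finRange] at h₂ h₃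
  exact h₁.seq (h₂.seq h₃)

theorem runs_blowupClauses (l : List (CSPClause k (Fin N))) :
    (blowupClauses k m).Runs (l.length * (clauseTime k N R + 1) + 1)
      (store (l.flatMap CSPInstance.encodeClause) o (counters m N b R 0))
      (store [] ((l.reverse.flatMap fun C => (shifts R (List.finRange k)
        (fun x => C.vars x * R)).flatMap (encodeRaw C.pred)) ++ o) (counters m N b R 0)) := by
  induction l generalizing o with
  | nil =>
    simp only [List.length_nil, zero_mul, zero_add, List.reverse_nil, List.flatMap_nil,
      List.nil_append]
    exact runs_scan_nil rfl
  | cons C l ih =>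
    have h₁ := runs_blowupClause (m := m) (b := b) (R := R) (o := o)
      (i := l.flatMap CSPInstance.encodeClause) C
    have h₂ := ih (o := (shifts R (List.finRange k) (fun x => C.vars x * R)).flatMap
      (encodeRaw C.pred) ++ o)
    have h₃ := runs_scan_cons (k := inp) (halt := fun _ => false)
      (s := store ((C :: l).flatMap CSPInstance.encodeClause) o (counters m N b R 0))
      (body := fun a => match a with | .pred f => blowupClause m f | _ => skip)
      (a := CSPSymbol.pred C.pred) rfl rfl
      (by rw [store_update_inp]; exact h₁) h₂
    rw [← List.append_assoc] at h₃
    have e : ((C :: l).reverse.flatMap fun C => (shifts R (List.finRange k)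
        (fun x => C.vars x * R)).flatMap (encodeRaw C.pred)) =
        (l.reverse.flatMap fun C => (shifts R (List.finRange k)
        (fun x => C.vars x * R)).flatMap (encodeRaw C.pred)) ++
        (shifts R (List.finRange k) (fun x => C.vars x * R)).flatMap (encodeRaw C.pred) := by
      simp
    rw [e]
    refine Runs.mono h₃ ?_
    rw [List.length_cons, add_mul]
    omega

theorem runs_forEach_inc_pow :
    (forEach (List.finRange m) fun j => inc (pow j)).Runs (m + 1)
      (store i o (counters m N b R a)) (store i o (counters m N (b + 1) R a)) := by
  have h := runs_forEach_inc (i := i) (o := o) (n := counters m N b R a) pow (List.finRange m)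
  rw [List.length_finRange, ← Fin.sum_univ_def] at h
  have e : counters m N b R a + ∑ j, Pi.single (pow j) 1 = counters m N (b + 1) R a := by
    funext c
    cases c <;> simp [counters, Finset.sum_apply, Pi.single_apply]
  rwa [e] at h

theorem runs_readSize (v : ℕ) :
    (readSize k m).Runs (v * (m + 3) + 1)
      (store (CSPInstance.encodeNum k v ++ i) o (counters m N b R a))
      (store i o (counters m (N + v) (b + v) R a)) := by
  induction v generalizing N b with
  | zero =>
    have h := runs_scan_stop (s := store (.sep :: i) o (counters m N b R a)) (k := inp)
      (a := CSPSymbol.sep) (l := i) (halt := fun a => decide (a = .sep))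
      (body := fun _ => (inc size).seq (forEach (List.finRange m) fun j => inc (pow j)))
      rfl (by simp)
    rw [store_update_inp] at h
    exact Runs.mono h (by omega)
  | succ v ih =>
    have h₁ := runs_inc (i := CSPInstance.encodeNum k v ++ i) (o := o)
      (n := counters m N b R a) size
    have e : counters m N b R a + Pi.single size 1 = counters m (N + 1) b R a := by
      funext c
      cases c <;> simp [counters]
    rw [e] at h₁
    have h₂ := ih (N := N + 1) (b := b + 1)
    rw [add_right_comm N, add_right_comm b, add_assoc N, add_assoc b] at h₂
    refine (runs_scan_cons (a := CSPSymbol.tick) (l := CSPInstance.encodeNum k v ++ i) ?_ ?_ ?_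
      h₂).mono (t := 1 + (1 + (m + 1)) + (v * (m + 3) + 1)) ?_
    · simp [store, CSPInstance.encodeNum, List.replicate_succ]
    · simp
    · rw [store_update_inp]
      exact h₁.seq runs_forEach_inc_pow
    · rw [add_mul]
      omega

/-- The time that `finish` takes. -/
def finishTime (k m N b R : ℕ) : ℕ :=
  1 + (N * (R * 5 + 2 + 1) + 1 + (R * 2 + 1 + (m * (b * 2 + 1) + 1 + (k * (R * 2 + 1) + 1))))

theorem runs_finish :
    (finish k m).Runs (finishTime k m N b R) (store i o (counters m N b R 0))
      (store i (CSPInstance.encodeNum k (N * R) ++ o) 0) := by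
  have h₁ := runs_emit (i := i) (o := o) (n := counters m N b R (0 : Fin k → ℕ)) .sep
  have h₂ := runs_drain (i := i) (c := size) (P := rep radix radixAux (emit _ .tick))
    (T := R * 5 + 2) N (fun t => List.replicate (t * R) .tick ++ .sep :: o)
    (fun _ => counters m N b R (0 : Fin k → ℕ)) (fun t _ => by
      have h := runs_rep_emit (i := i) (o := List.replicate (t * R) .tick ++ .sep :: o)
        (n := Function.update (counters m N b R (0 : Fin k → ℕ)) size (N - (t + 1)))
        (c := radix) (d := radixAux) (by simp) (by simp [counters])
      have e : Function.update (counters m N b R (0 : Fin k → ℕ)) size (N - (t + 1)) radix = R :=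
        rfl
      rw [e, ← List.append_assoc, ← List.replicate_add,
        show R + t * R = (t + 1) * R by ring] at h
      exact h)
  rw [show Function.update (counters m N b R (0 : Fin k → ℕ)) size N =
    counters m N b R 0 from Function.update_eq_self size _] at h₂
  simp only [zero_mul, List.replicate_zero, List.nil_append] at h₂
  have h₃ := runs_clear (i := i) (o := List.replicate (N * R) .tick ++ .sep :: o)
    (n := Function.update (counters m N b R (0 : Fin k → ℕ)) size 0) radix
  have h₄ := runs_forEach_clear (i := i) (o := List.replicate (N * R) .tick ++ .sep :: o)
    (n := Function.update (Function.update (counters m N b R (0 : Fin k → ℕ)) size 0) radix 0)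
    (B := b) pow (List.finRange m) (fun x => by simp [counters])
  have h₅ := runs_forEach_clear (i := i) (o := List.replicate (N * R) .tick ++ .sep :: o)
    (n := fun c => open scoped Classical in if c ∈ (List.finRange m).map pow then 0 else
      Function.update (Function.update (counters m N b R (0 : Fin k → ℕ)) size 0) radix 0 c)
    (B := R) rad (List.finRange k) (fun x => by simp [counters])
  have e : (fun c => open scoped Classical in if c ∈ (List.finRange k).map rad then 0 else
      if c ∈ (List.finRange m).map pow then 0 else Function.update
        (Function.update (counters m N b R (0 : Fin k → ℕ)) size 0) radix 0 c) = 0 := by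
    funext c
    cases c <;> simp [counters]
  rw [List.length_finRange] at h₄ h₅
  rw [e] at h₅
  have h := h₁.seq (h₂.seq (h₃.seq (h₄.seq h₅)))
  rw [CSPInstance.encodeNum, List.append_assoc]
  exact h

/-- The time that `blowupProg` takes. -/
def blowupTime (k m N M : ℕ) : ℕ :=
  N * (m + 3) + 1 + (m + 1 + (radixTime k (N + 1) m +
    (M * (clauseTime k N ((N + 1) ^ m) + 1) + 1 + finishTime k m N (N + 1) ((N + 1) ^ m))))

theorem runs_blowupProg (Φ : CSPInstance k) :
    (blowupProg k m).Runs (blowupTime k m Φ.numVars Φ.formula.clauses.length)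
      (store Φ.encode [] 0)
      (store [] (CSPInstance.encodeNum k (Φ.numVars * (Φ.numVars + 1) ^ m) ++
        Φ.formula.clauses.reverse.flatMap fun C => (shifts ((Φ.numVars + 1) ^ m)
          (List.finRange k) (fun x => C.vars x * (Φ.numVars + 1) ^ m)).flatMap
            (encodeRaw C.pred)) 0) := by
  have h₁ := runs_readSize (m := m) (i := Φ.formula.clauses.flatMap CSPInstance.encodeClause)
    (o := []) (N := 0) (b := 0) (R := 0) (a := (0 : Fin k → ℕ)) Φ.numVars
  rw [counters_zero, zero_add] at h₁
  have h₂ := runs_forEach_inc_pow (m := m)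
    (i := Φ.formula.clauses.flatMap CSPInstance.encodeClause) (o := []) (N := Φ.numVars)
    (b := Φ.numVars) (R := 0) (a := (0 : Fin k → ℕ))
  have h₃ := runs_computeRadix (b := Φ.numVars + 1)
    (i := Φ.formula.clauses.flatMap CSPInstance.encodeClause) (o := [])
    (n := counters m Φ.numVars (Φ.numVars + 1) 0 (0 : Fin k → ℕ)) (List.finRange m)
    (List.nodup_finRange m) (fun _ _ => rfl) (fun _ _ => rfl)
  have e : ∀ R, counters m Φ.numVars (Φ.numVars + 1) 0 (0 : Fin k → ℕ) +
      R • (Pi.single radix 1 + ∑ i, Pi.single (rad i) 1) =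
      counters m Φ.numVars (Φ.numVars + 1) R (0 : Fin k → ℕ) := by
    intro R
    funext c
    cases c <;> simp [counters, Finset.sum_apply, Pi.single_apply]
  rw [e, List.length_finRange] at h₃
  have h₄ := runs_blowupClauses (m := m) (b := Φ.numVars + 1) (R := (Φ.numVars + 1) ^ m)
    (o := []) Φ.formula.clauses
  rw [List.append_nil] at h₄
  exact h₁.seq (h₂.seq (h₃.seq (h₄.seq runs_finish)))

end StackProg

/-! ### The blowup as an instance, and its agreement with the output of the program. -/

namespace StackProg

theorem mem_shifts {ι : Type} [DecidableEq ι] {R : ℕ} {l : List ι} (hl : l.Nodup) {a b : ι → ℕ} :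
    b ∈ shifts R l a ↔ (∀ i ∈ l, a i ≤ b i ∧ b i < a i + R) ∧ ∀ i ∉ l, b i = a i := by
  induction l generalizing a with
  | nil => simp [shifts, funext_iff]
  | cons x l ih =>
    obtain ⟨hx, hl⟩ := List.nodup_cons.1 hl
    simp only [shifts, List.mem_flatMap, List.mem_reverse, List.mem_range, ih hl]
    constructor
    · rintro ⟨j, hj, h₁, h₂⟩
      refine ⟨fun i hi => ?_, fun i hi => ?_⟩
      · by_cases hix : i = x
        · subst hix
          have := h₂ i hx
          simp only [Function.update_self] at this
          omega
        · have := h₁ i ((List.mem_cons.1 hi).resolve_left hix)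
          simpa [hix] using this
      · have hix : i ≠ x := fun h => hi (by simp [h])
        have := h₂ i (fun h => hi (by simp [h]))
        simpa [hix] using this
    · rintro ⟨h₁, h₂⟩
      have hxx := h₁ x (by simp)
      refine ⟨b x - a x, by omega, fun i hi => ?_, fun i hi => ?_⟩
      · have hix : i ≠ x := fun h => hx (h ▸ hi)
        simpa [hix] using h₁ i (by simp [hi])
      · by_cases hix : i = x
        · subst hix
          simp only [Function.update_self]
          omega
        · simpa [hix] using h₂ i (by simp [hix, hi])

theorem nodup_shifts {ι : Type} [DecidableEq ι] (R : ℕ) {l : List ι} (hl : l.Nodup) (a : ι → ℕ) :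
    (shifts R l a).Nodup := by
  induction l generalizing a with
  | nil => simp [shifts]
  | cons x l ih =>
    obtain ⟨hx, hl⟩ := List.nodup_cons.1 hl
    rw [shifts, List.nodup_flatMap]
    refine ⟨fun j _ => ih hl _, ?_⟩
    refine (List.nodup_reverse.2 List.nodup_range).imp fun {j j'} hjj b hb hb' => hjj ?_
    have h := ((mem_shifts hl).1 hb).2 x hx
    have h' := ((mem_shifts hl).1 hb').2 x hx
    simp only [Function.update_self] at h h'
    omega

end StackProg

namespace CSPInstance

open StackProg

variable {k N R : ℕ}

/-- The copy of the clause `D` with variables `b`, where the copies of the variable `v` are the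
numbers from `v * R` to `v * R + R - 1`. -/
def copyClause (D : CSPClause k (Fin N)) (b : Fin k → ℕ)
    (hb : ∀ i, (D.vars i : ℕ) * R ≤ b i ∧ b i < (D.vars i : ℕ) * R + R) : CSPClause k (Fin (N * R)) where
  pred := D.pred
  vars :=
    { toFun := fun i => ⟨b i, (hb i).2.trans_le (by
        rw [← Nat.succ_mul]
        exact Nat.mul_le_mul_right _ (D.vars i).2)⟩
      inj' := fun i j hij => by
        have hi := hb i
        have hj := hb j
        rw [show b i = b j from congrArg Fin.val hij] at hi
        refine D.vars.injective (Fin.ext ?_)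
        -- Division by `R` recovers a variable from any of its copies, so copies of distinct
        -- variables are distinct.
        rw [← Nat.div_eq_of_lt_le hi.1 (by rw [Nat.succ_mul]; exact hi.2),
          ← Nat.div_eq_of_lt_le hj.1 (by rw [Nat.succ_mul]; exact hj.2)] }

/-- The clauses that result from replacing the variables of the clause `D` by their copies. -/
def cloud (R : ℕ) (D : CSPClause k (Fin N)) : List (CSPClause k (Fin (N * R))) :=
  (shifts R (List.finRange k) (fun i => (D.vars i : ℕ) * R)).pmap (copyClause D)
    (fun _ hb i => ((mem_shifts (List.nodup_finRange k)).1 hb).1 i (List.mem_finRange i))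

/-- The `R`-blowup of an instance. -/
def blowup (R : ℕ) (Φ : CSPInstance k) : CSPInstance k where
  numVars := Φ.numVars * R
  -- The order is that of the program's output: clauses read later are written in front.
  formula := ⟨Φ.formula.clauses.reverse.flatMap (cloud R)⟩

theorem mem_cloud {D : CSPClause k (Fin N)} {C : CSPClause k (Fin (N * R))} :
    C ∈ cloud R D ↔
      C.pred = D.pred ∧ ∀ i, (D.vars i : ℕ) * R ≤ (C.vars i : ℕ) ∧
        (C.vars i : ℕ) < (D.vars i : ℕ) * R + R := by
  rw [cloud, List.mem_pmap]
  constructor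
  · rintro ⟨b, hb, rfl⟩
    exact ⟨rfl, fun i => ((mem_shifts (List.nodup_finRange k)).1 hb).1 i (List.mem_finRange i)⟩
  · rintro ⟨h₁, h₂⟩
    refine ⟨fun i => C.vars i, (mem_shifts (List.nodup_finRange k)).2
      ⟨fun i _ => h₂ i, fun i hi => absurd (List.mem_finRange i) hi⟩, ?_⟩
    ext1
    · exact h₁.symm
    · rfl

theorem nodup_cloud (D : CSPClause k (Fin N)) : (cloud R D).Nodup := by
  refine (nodup_shifts R (List.nodup_finRange k) _).pmap fun b _ b' _ h => ?_
  funext i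
  exact congrArg (fun C : CSPClause k (Fin (N * R)) => (C.vars i : ℕ)) h

theorem mem_cloud_iff_exists {D : CSPClause k (Fin N)} {C : CSPClause k (Fin (N * R))} :
    C ∈ cloud R D ↔ ∃ j : Fin k → Fin R,
      C.pred = D.pred ∧ ∀ i, C.vars i = finProdFinEquiv (D.vars i, j i) := by
  rw [mem_cloud]
  constructor
  · rintro ⟨h₁, h₂⟩
    refine ⟨fun i => ⟨(C.vars i : ℕ) - (D.vars i : ℕ) * R, by have := h₂ i; omega⟩, h₁, fun i => ?_⟩
    ext
    have := h₂ i
    simp only [finProdFinEquiv_apply_val]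
    rw [mul_comm R]
    omega
  · rintro ⟨j, h₁, h₂⟩
    refine ⟨h₁, fun i => ?_⟩
    rw [h₂ i]
    simp only [finProdFinEquiv_apply_val]
    have := (j i).2
    rw [mul_comm R]
    omega

theorem isBlowup_blowup (R : ℕ) (Φ : CSPInstance k) : IsBlowup R Φ (blowup R Φ) := by
  refine ⟨finProdFinEquiv, fun C => ?_⟩
  refine List.mem_flatMap.trans (exists_congr fun D => ?_)
  rw [List.mem_reverse]
  exact and_congr_right fun _ => mem_cloud_iff_exists

theorem simple_blowup (R : ℕ) {Φ : CSPInstance k} (hΦ : Φ.formula.Simple) :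
    (blowup R Φ).formula.Simple := by
  change (Φ.formula.clauses.reverse.flatMap (cloud R)).Nodup
  rw [List.nodup_flatMap]
  refine ⟨fun D _ => nodup_cloud D, (List.nodup_reverse.2 hΦ).imp fun {D D'} hDD C hC hC' =>
    hDD ?_⟩
  obtain ⟨j, h₁, h₂⟩ := mem_cloud_iff_exists.1 hC
  obtain ⟨j', h₁', h₂'⟩ := mem_cloud_iff_exists.1 hC'
  ext1
  · rw [← h₁, ← h₁']
  · ext i
    have := finProdFinEquiv.injective ((h₂ i).symm.trans (h₂' i))
    exact congrArg Fin.val (Prod.mk.inj this).1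

theorem IsBlowup.preds_eq {Φ Ψ : CSPInstance k} (h : IsBlowup R Φ Ψ) (hR : 0 < R) :
    Ψ.formula.preds = Φ.formula.preds := by
  obtain ⟨e, he⟩ := h
  ext f
  constructor
  · rintro ⟨C, hC, rfl⟩
    obtain ⟨D, hD, j, h₁, -⟩ := (he C).1 hC
    exact ⟨D, hD, h₁.symm⟩
  · rintro ⟨D, hD, rfl⟩
    refine ⟨⟨D.pred, ⟨fun i => e (D.vars i, ⟨0, hR⟩), fun i j hij => ?_⟩⟩,
      (he _).2 ⟨D, hD, fun _ => ⟨0, hR⟩, rfl, fun i => rfl⟩, rfl⟩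
    exact D.vars.injective (Prod.mk.inj (e.injective hij)).1

theorem flatMap_pmap_eq {α β γ : Type*} {p : α → Prop} (f : ∀ a, p a → β) (g : β → List γ)
    (g' : α → List γ) (hg : ∀ a h, g (f a h) = g' a) (l : List α) (hl : ∀ a ∈ l, p a) :
    (l.pmap f hl).flatMap g = l.flatMap g' := by
  induction l with
  | nil => rfl
  | cons a l ih => simp [hg, ih]

theorem encode_blowup (R : ℕ) (Φ : CSPInstance k) :
    (blowup R Φ).encode = encodeNum k (Φ.numVars * R) ++
      Φ.formula.clauses.reverse.flatMap fun C => (shifts R (List.finRange k)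
        (fun x => C.vars x * R)).flatMap (encodeRaw C.pred) := by
  change encodeNum k (Φ.numVars * R) ++
    (Φ.formula.clauses.reverse.flatMap (cloud R)).flatMap encodeClause = _
  rw [List.flatMap_assoc]
  congr 2
  funext D
  exact flatMap_pmap_eq (copyClause D) encodeClause (encodeRaw D.pred) (fun b hb => rfl) _ _

/-! ### Polynomial bounds on the running time. -/

/-- The function `g` is bounded by a polynomial in the size of the instance. -/
def PolyBounded (g : CSPInstance k → ℕ) : Prop :=
  ∃ p : Polynomial ℕ, ∀ Φ : CSPInstance k, g Φ ≤ p.eval Φ.encode.length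

theorem PolyBounded.const (c : ℕ) : PolyBounded fun _ : CSPInstance k => c :=
  ⟨Polynomial.C c, fun Φ => by simp⟩

theorem PolyBounded.add {g h : CSPInstance k → ℕ} (hg : PolyBounded g) (hh : PolyBounded h) :
    PolyBounded fun Φ => g Φ + h Φ := by
  obtain ⟨p, hp⟩ := hg
  obtain ⟨q, hq⟩ := hh
  exact ⟨p + q, fun Φ => by rw [Polynomial.eval_add]; exact add_le_add (hp Φ) (hq Φ)⟩

theorem PolyBounded.mul {g h : CSPInstance k → ℕ} (hg : PolyBounded g) (hh : PolyBounded h) :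
    PolyBounded fun Φ => g Φ * h Φ := by
  obtain ⟨p, hp⟩ := hg
  obtain ⟨q, hq⟩ := hh
  exact ⟨p * q, fun Φ => by rw [Polynomial.eval_mul]; exact Nat.mul_le_mul (hp Φ) (hq Φ)⟩

theorem PolyBounded.pow {g : CSPInstance k → ℕ} (hg : PolyBounded g) (m : ℕ) :
    PolyBounded fun Φ => g Φ ^ m := by
  induction m with
  | zero => exact .const 1
  | succ m ih => exact ih.mul hg

theorem polyBounded_numVars : PolyBounded fun Φ : CSPInstance k => Φ.numVars :=
  ⟨Polynomial.X, fun Φ => by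
    simp only [encode, encodeNum, List.length_append, List.length_replicate, Polynomial.eval_X]
    omega⟩

theorem polyBounded_length : PolyBounded fun Φ : CSPInstance k => Φ.formula.clauses.length := by
  refine ⟨Polynomial.X, fun Φ => ?_⟩
  have h : ∀ {n : ℕ} (l : List (CSPClause k (Fin n))),
      l.length ≤ (l.flatMap encodeClause).length := by
    intro n l
    induction l with
    | nil => simp
    | cons C l ih =>
      simp only [List.length_cons, List.flatMap_cons, List.length_append, encodeClause]
      omega
  have := h Φ.formula.clauses
  simp only [encode, List.length_append, Polynomial.eval_X]
  omega

theorem PolyBounded.cloudTime {g h : CSPInstance k → ℕ} (hg : PolyBounded g)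
    (hh : PolyBounded h) (l : ℕ) : PolyBounded fun Φ => cloudTime k (g Φ) (h Φ) l := by
  induction l with
  | zero =>
    exact ((PolyBounded.const k).mul (((PolyBounded.const 5).mul hh).add (.const 3))).add (.const 2)
  | succ l ih => exact (hg.mul (ih.add (.const 10))).add (.const 4)

theorem PolyBounded.radixTime {g : CSPInstance k → ℕ} (hg : PolyBounded g) (l : ℕ) :
    PolyBounded fun Φ => radixTime k (g Φ) l := by
  induction l with
  | zero => exact .const (k + 2)
  | succ l ih => exact (hg.mul (ih.add (.const 4))).add (.const 2)

theorem polyBounded_blowupTime (m : ℕ) :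
    PolyBounded fun Φ : CSPInstance k => blowupTime k m Φ.numVars Φ.formula.clauses.length := by
  have hN := polyBounded_numVars (k := k)
  have hM := polyBounded_length (k := k)
  have c := PolyBounded.const (k := k)
  have hb := hN.add (c 1)
  have hR := hb.pow m
  have hread := (hN.mul (((c 5).mul hR).add (c 3))).add (c 1)
  have hNR := hN.mul hR
  have hclause := (((c k).mul hread).add (c 1)).add
    ((hR.cloudTime hNR k).add (((c k).mul ((hNR.mul (c 2)).add (c 1))).add (c 1)))
  have hfinish := (c 1).add (((hN.mul (((hR.mul (c 5)).add (c 2)).add (c 1))).add (c 1)).add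
    (((hR.mul (c 2)).add (c 1)).add ((((c m).mul ((hb.mul (c 2)).add (c 1))).add (c 1)).add
      (((c k).mul ((hR.mul (c 2)).add (c 1))).add (c 1)))))
  exact ((hN.mul (c (m + 3))).add (c 1)).add ((c (m + 1)).add ((hb.radixTime m).add
    (((hM.mul (hclause.add (c 1))).add (c 1)).add hfinish)))

theorem polyTimeReduction_blowup (k m : ℕ) :
    PolyTimeReduction fun Φ : CSPInstance k => blowup ((Φ.numVars + 1) ^ m) Φ := by
  obtain ⟨p, hp⟩ := polyBounded_blowupTime (k := k) m
  refine computableInPolyTime (blowupProg k m) .inp .out p fun Φ => ?_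
  have e₀ : Function.update (fun _ => []) .inp Φ.encode =
      store Φ.encode [] (0 : BlowupCounter k m → ℕ) := by
    funext s
    rcases s with _ | _ | c <;> simp [store]
  have e₁ : ∀ o : List (CSPSymbol k), Function.update (fun _ => []) .out o =
      store [] o (0 : BlowupCounter k m → ℕ) := by
    intro o
    funext s
    rcases s with _ | _ | c <;> simp [store]
  rw [e₀, e₁, encode_blowup]
  exact (runs_blowupProg Φ).mono (hp Φ)

end CSPInstance

/-! ### Lifts of formulas and the comparison of their values. -/

namespace CSPFormula

open Finset

variable {k : ℕ} {U V : Type*}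

theorem valAt_nonneg (φ : CSPFormula k V) (σ : V → Bool) : 0 ≤ φ.valAt σ := by
  unfold valAt
  split_ifs <;> positivity

theorem valAt_le_one (φ : CSPFormula k V) (σ : V → Bool) : φ.valAt σ ≤ 1 := by
  unfold valAt
  split_ifs
  · exact le_rfl
  · exact div_le_one_of_le₀ (by exact_mod_cast List.countP_le_length) (by positivity)

theorem valAt_le_val (φ : CSPFormula k V) (σ : V → Bool) : φ.valAt σ ≤ φ.val :=
  le_ciSup (f := fun σ => φ.valAt σ) ⟨1, by rintro _ ⟨σ, rfl⟩; exact φ.valAt_le_one σ⟩ σ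

theorem val_le {φ : CSPFormula k V} {x : ℝ} (h : ∀ σ, φ.valAt σ ≤ x) : φ.val ≤ x :=
  ciSup_le h

theorem val_nonneg (φ : CSPFormula k V) : 0 ≤ φ.val :=
  (φ.valAt_nonneg fun _ => false).trans (φ.valAt_le_val _)

theorem val_le_one (φ : CSPFormula k V) : φ.val ≤ 1 := val_le φ.valAt_le_one

theorem exists_valAt_eq_val [Finite V] (φ : CSPFormula k V) : ∃ σ, φ.valAt σ = φ.val :=
  exists_eq_ciSup_of_finite

theorem valAt_of_clauses_eq_nil {φ : CSPFormula k V} (h : φ.clauses = []) (σ : V → Bool) :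
    φ.valAt σ = 1 := by
  simp [valAt, h]

theorem valAt_eq_one_iff {φ : CSPFormula k V} {σ : V → Bool} :
    φ.valAt σ = 1 ↔ ∀ C ∈ φ.clauses, C.sat σ := by
  unfold valAt
  split_ifs with h
  · simp [h]
  · have h' : (φ.clauses.length : ℝ) ≠ 0 := by
      simpa using h
    rw [div_eq_one_iff_eq h', Nat.cast_inj, List.countP_eq_length]

theorem valAt_eq_card_div_card [DecidableEq (CSPClause k V)] {φ : CSPFormula k V}
    (hφ : φ.Simple) (h : φ.clauses ≠ []) (σ : V → Bool) :
    φ.valAt σ = (#{C ∈ φ.clauses.toFinset | C.sat σ} : ℝ) / #φ.clauses.toFinset := by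
  rw [valAt, if_neg h, List.toFinset_card_of_nodup hφ, ← List.toFinset_filter,
    List.toFinset_card_of_nodup (List.Nodup.filter _ hφ), List.countP_eq_length_filter]

/-- The clauses of `ψ` are precisely the lifts along `π` of the clauses of `φ`. -/
structure IsLift (π : U → V) (φ : CSPFormula k V) (ψ : CSPFormula k U) : Prop where
  simple : ψ.Simple
  mem_iff : ∀ C, C ∈ ψ.clauses ↔
    ∃ D ∈ φ.clauses, C.pred = D.pred ∧ ∀ i, π (C.vars i) = D.vars i

/-- A satisfying assignment pulls back along `π`. Nothing is needed about the fibers, which is why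
percolation preserves satisfiability with certainty. -/
theorem IsLift.val_eq_one [Finite V] {π : U → V} {φ : CSPFormula k V} {ψ : CSPFormula k U}
    (h : IsLift π φ ψ) (hφ : φ.val = 1) : ψ.val = 1 := by
  obtain ⟨τ, hτ⟩ := φ.exists_valAt_eq_val
  rw [hφ, valAt_eq_one_iff] at hτ
  refine le_antisymm ψ.val_le_one ?_
  rw [← valAt_eq_one_iff (σ := τ ∘ π) |>.2 ?_]
  · exact ψ.valAt_le_val _
  · intro C hC
    obtain ⟨D, hD, hp, hv⟩ := (h.mem_iff C).1 hC
    have := hτ D hD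
    unfold CSPClause.sat at this ⊢
    simpa [hp, hv] using this

theorem IsLift.clauses_eq_nil {π : U → V} {φ : CSPFormula k V} {ψ : CSPFormula k U}
    (h : IsLift π φ ψ) (hφ : φ.clauses = []) : ψ.clauses = [] := by
  rw [List.eq_nil_iff_forall_not_mem]
  intro C hC
  obtain ⟨D, hD, -⟩ := (h.mem_iff C).1 hC
  simp [hφ] at hD

section Counting

variable [Fintype U] [DecidableEq V]

/-- The elements of `U` over `v`. -/
def fiber (π : U → V) (v : V) : Finset U := {u | π u = v}

/-- The tuples over the variables of the clause `D`. -/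
def lifts (π : U → V) (D : CSPClause k V) : Finset (Fin k → U) :=
  Fintype.piFinset fun i => fiber π (D.vars i)

theorem mem_lifts {π : U → V} {D : CSPClause k V} {u : Fin k → U} :
    u ∈ lifts π D ↔ ∀ i, π (u i) = D.vars i := by
  simp [lifts, fiber]

theorem card_lifts (π : U → V) (D : CSPClause k V) :
    #(lifts π D) = ∏ i, #(fiber π (D.vars i)) := Fintype.card_piFinset _

/-- The number of clauses of a lift with a given property. -/
theorem IsLift.card_filter [DecidableEq (CSPClause k U)] [DecidableEq (CSPClause k V)]
    {π : U → V} {φ : CSPFormula k V} {ψ : CSPFormula k U} (h : IsLift π φ ψ)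
    (p : BoolPred k → (Fin k → U) → Bool) :
    #{C ∈ ψ.clauses.toFinset | p C.pred C.vars} =
      ∑ D ∈ φ.clauses.toFinset, #{u ∈ lifts π D | p D.pred u} := by
  rw [← Finset.card_sigma]
  symm
  -- The entries of a lifted tuple lie over distinct variables, so they are distinct and every pair
  -- of a clause and a tuple over it is a genuine clause of the lift.
  have hinj : ∀ x : (Σ _ : CSPClause k V, Fin k → U),
      x ∈ φ.clauses.toFinset.sigma
        (fun D => {u ∈ lifts π D | p D.pred u}) → Function.Injective x.2 := by
    intro x hx i j hij
    have hu := mem_lifts.1 (mem_filter.1 (mem_sigma.1 hx).2).1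
    exact x.1.vars.injective (by rw [← hu i, ← hu j, hij])
  refine Finset.card_bij (fun x hx => ⟨x.1.pred, ⟨x.2, hinj x hx⟩⟩) ?_ ?_ ?_
  · intro x hx
    have h₁ := List.mem_toFinset.1 (mem_sigma.1 hx).1
    obtain ⟨h₂, h₃⟩ := mem_filter.1 (mem_sigma.1 hx).2
    rw [mem_filter, List.mem_toFinset, h.mem_iff]
    exact ⟨⟨x.1, h₁, rfl, mem_lifts.1 h₂⟩, h₃⟩
  · rintro ⟨D, u⟩ hx ⟨D', u'⟩ hx' hxx
    have h₂ := mem_lifts.1 (mem_filter.1 (mem_sigma.1 hx).2).1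
    have h₂' := mem_lifts.1 (mem_filter.1 (mem_sigma.1 hx').2).1
    simp only [CSPClause.mk.injEq, Function.Embedding.mk.injEq] at hxx
    obtain ⟨hp, hu⟩ := hxx
    obtain rfl : u = u' := hu
    obtain rfl : D = D' := by
      ext1
      · exact hp
      · ext i
        rw [← h₂ i, ← h₂' i]
    rfl
  · intro C hC
    obtain ⟨h₁, h₂⟩ := mem_filter.1 hC
    obtain ⟨D, hD, hp, hv⟩ := (h.mem_iff C).1 (List.mem_toFinset.1 h₁)
    refine ⟨⟨D, C.vars⟩, mem_sigma.2 ⟨List.mem_toFinset.2 hD, mem_filter.2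
      ⟨mem_lifts.2 hv, ?_⟩⟩, ?_⟩
    · rwa [hp] at h₂
    · ext1
      · exact hp.symm
      · rfl

theorem IsLift.card [DecidableEq (CSPClause k U)] [DecidableEq (CSPClause k V)]
    {π : U → V} {φ : CSPFormula k V} {ψ : CSPFormula k U} (h : IsLift π φ ψ) :
    #ψ.clauses.toFinset = ∑ D ∈ φ.clauses.toFinset, #(lifts π D) := by
  simpa using h.card_filter fun _ _ => true

/-- The sections of `π`. -/
def sections [Fintype V] (π : U → V) : Finset (V → U) := Fintype.piFinset (fiber π)

/-- A uniformly random section, restricted to the variables of `D`, is a uniformly random lift of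
`D`. Multiplying out the denominators avoids a case distinction on empty fibers. -/
theorem card_sections_filter [Fintype V] (π : U → V) (D : CSPClause k V)
    (p : (Fin k → U) → Bool) :
    #{J ∈ sections π | p (fun i => J (D.vars i))} * #(lifts π D) =
      #{u ∈ lifts π D | p u} * #(sections π) := by
  classical
  obtain ⟨c, hc⟩ : ∃ c, ∀ u ∈ lifts π D,
      #{J ∈ sections π | (fun i => J (D.vars i)) = u} = c := by
    -- A section that extends `u` is prescribed on the variables of `D` and free elsewhere, so the
    -- number of extensions does not depend on `u`.
    refine ⟨∏ v, if v ∈ Set.range D.vars then 1 else #(fiber π v), fun u hu => ?_⟩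
    have e : {J ∈ sections π | (fun i => J (D.vars i)) = u} = Fintype.piFinset
        (fun v => if h : v ∈ Set.range D.vars then {u h.choose} else fiber π v) := by
      ext J
      simp only [sections, mem_filter, Fintype.mem_piFinset]
      constructor
      · rintro ⟨hJ, rfl⟩ v
        split_ifs with h
        · exact mem_singleton.2 (congrArg J h.choose_spec.symm)
        · exact hJ v
      · intro hJ
        have hJu : ∀ i, J (D.vars i) = u i := fun i => by
          have h : D.vars i ∈ Set.range D.vars := ⟨i, rfl⟩
          have := hJ (D.vars i)
          rw [dif_pos h, mem_singleton] at this
          exact this.trans (congrArg u (D.vars.injective h.choose_spec))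
        refine ⟨fun v => ?_, funext hJu⟩
        by_cases h : v ∈ Set.range D.vars
        · obtain ⟨i, rfl⟩ := h
          rw [hJu]
          simpa [fiber] using mem_lifts.1 hu i
        · have := hJ v
          rwa [dif_neg h] at this
    rw [e, Fintype.card_piFinset]
    refine prod_congr rfl fun v _ => ?_
    split_ifs <;> simp
  have key : ∀ q : (Fin k → U) → Bool,
      #{J ∈ sections π | q (fun i => J (D.vars i))} = #{u ∈ lifts π D | q u} * c := by
    intro q
    rw [Finset.card_eq_sum_card_fiberwise (f := fun J i => J (D.vars i))
      (t := {u ∈ lifts π D | q u})]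
    · rw [← smul_eq_mul, ← sum_const]
      refine sum_congr rfl fun u hu => ?_
      obtain ⟨hu₁, hu₂⟩ := mem_filter.1 hu
      rw [← hc u hu₁, filter_filter]
      congr 1
      ext J
      simp only [mem_filter, and_congr_right_iff, and_iff_right_iff_imp]
      rintro - rfl
      exact hu₂
    · intro J hJ
      simp only [coe_filter, Set.mem_ofPred_eq, sections, Fintype.mem_piFinset] at hJ ⊢
      refine ⟨mem_lifts.2 fun i => ?_, hJ.2⟩
      simpa [fiber] using hJ.1 (D.vars i)
  have h₁ := key p
  have h₂ := key fun _ => true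
  simp only [filter_true] at h₂
  rw [h₁, h₂]
  ring

variable {π : U → V} {φ : CSPFormula k V} {ψ : CSPFormula k U} {lo hi : ℝ}

theorem pow_le_card_lifts (hlo : 0 ≤ lo) (h : ∀ v, lo ≤ #(fiber π v)) (D : CSPClause k V) :
    lo ^ k ≤ #(lifts π D) := by
  rw [card_lifts, Nat.cast_prod]
  simpa using prod_le_prod (s := univ) (f := fun _ : Fin k => lo) (fun _ _ => hlo)
    (fun i _ => h (D.vars i))

theorem card_lifts_le_pow (h : ∀ v, #(fiber π v) ≤ hi) (D : CSPClause k V) :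
    #(lifts π D) ≤ hi ^ k := by
  rw [card_lifts, Nat.cast_prod]
  simpa using prod_le_prod (s := univ) (g := fun _ : Fin k => hi) (fun _ _ => Nat.cast_nonneg _)
    (fun i _ => h (D.vars i))

theorem IsLift.pow_mul_length_le (h : IsLift π φ ψ) (hφ : φ.Simple) (hlo : 0 ≤ lo)
    (hl : ∀ v, lo ≤ #(fiber π v)) :
    lo ^ k * φ.clauses.length ≤ ψ.clauses.length := by
  classical
  rw [← List.toFinset_card_of_nodup hφ, ← List.toFinset_card_of_nodup h.simple, h.card, mul_comm,
    ← nsmul_eq_mul, ← sum_const, Nat.cast_sum]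
  exact sum_le_sum fun D _ => pow_le_card_lifts hlo hl D

theorem IsLift.length_le_pow_mul (h : IsLift π φ ψ) (hφ : φ.Simple)
    (hh : ∀ v, #(fiber π v) ≤ hi) :
    ψ.clauses.length ≤ hi ^ k * φ.clauses.length := by
  classical
  rw [← List.toFinset_card_of_nodup hφ, ← List.toFinset_card_of_nodup h.simple, h.card, mul_comm,
    ← nsmul_eq_mul, ← sum_const, Nat.cast_sum]
  exact sum_le_sum fun D _ => card_lifts_le_pow hh D

theorem IsLift.clauses_ne_nil (h : IsLift π φ ψ) (hφ : φ.Simple) (hφ₀ : φ.clauses ≠ [])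
    (hlo : 0 < lo) (hl : ∀ v, lo ≤ #(fiber π v)) : ψ.clauses ≠ [] := by
  intro hψ
  have h' := h.pow_mul_length_le hφ hlo.le hl
  have : 0 < (φ.clauses.length : ℝ) := by exact_mod_cast List.length_pos_iff.2 hφ₀
  rw [hψ, List.length_nil, Nat.cast_zero] at h'
  have : 0 < lo ^ k * φ.clauses.length := by positivity
  linarith

/-- The value of a lift is at least that of the formula, up to the ratio of fiber sizes. -/
theorem IsLift.mul_val_le_val [Finite V] (h : IsLift π φ ψ) (hφ : φ.Simple) (hlo : 0 < lo)
    (hlh : lo ≤ hi) (hl : ∀ v, lo ≤ #(fiber π v)) (hh : ∀ v, #(fiber π v) ≤ hi) :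
    (lo / hi) ^ k * φ.val ≤ ψ.val := by
  classical
  have hhi := hlo.trans_le hlh
  obtain ⟨τ, hτ⟩ := φ.exists_valAt_eq_val
  refine le_trans ?_ (ψ.valAt_le_val (τ ∘ π))
  by_cases hφ₀ : φ.clauses = []
  · rw [valAt_of_clauses_eq_nil (h.clauses_eq_nil hφ₀)]
    exact mul_le_one₀ (pow_le_one₀ (by positivity) ((div_le_one hhi).2 hlh)) φ.val_nonneg
      φ.val_le_one
  have hψ₀ := h.clauses_ne_nil hφ hφ₀ hlo hl
  have hm : 0 < (#φ.clauses.toFinset : ℝ) := by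
    rw [List.toFinset_card_of_nodup hφ]
    exact_mod_cast List.length_pos_iff.2 hφ₀
  have hm' : 0 < (#ψ.clauses.toFinset : ℝ) := by
    rw [List.toFinset_card_of_nodup h.simple]
    exact_mod_cast List.length_pos_iff.2 hψ₀
  have hlen := h.length_le_pow_mul hφ hh
  rw [← List.toFinset_card_of_nodup hφ, ← List.toFinset_card_of_nodup h.simple] at hlen
  rw [← hτ, valAt_eq_card_div_card hφ hφ₀, valAt_eq_card_div_card h.simple hψ₀]
  -- Each clause satisfied by `τ` has at least `lo ^ k` lifts, all of them satisfied by `τ ∘ π`.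
  have hcard : lo ^ k * #{D ∈ φ.clauses.toFinset | D.sat τ} ≤
      (#{C ∈ ψ.clauses.toFinset | C.sat (τ ∘ π)} : ℝ) := by
    have e := h.card_filter fun f u => f fun i => τ (π (u i))
    have e' : #{C ∈ ψ.clauses.toFinset | C.sat (τ ∘ π)} = _ := e
    rw [e', Nat.cast_sum, Finset.card_filter, Nat.cast_sum, mul_sum]
    refine sum_le_sum fun D _ => ?_
    by_cases hD : D.sat τ
    · have e₂ : {u ∈ lifts π D | D.pred fun i => τ (π (u i))} = lifts π D := by
        refine filter_true_of_mem fun u hu => ?_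
        simp only [mem_lifts.1 hu]
        exact hD
      rw [e₂]
      simpa [hD] using pow_le_card_lifts hlo.le hl D
    · simp [hD]
  rw [div_pow, div_mul_div_comm, div_le_div_iff₀ (by positivity) hm']
  calc lo ^ k * #{D ∈ φ.clauses.toFinset | D.sat τ} * (#ψ.clauses.toFinset : ℝ)
      ≤ #{C ∈ ψ.clauses.toFinset | C.sat (τ ∘ π)} * (hi ^ k * #φ.clauses.toFinset) := by
        gcongr

/-- The value of a lift is at most that of the formula, up to the ratio of fiber sizes. -/
theorem IsLift.val_le_mul_val [Finite V] (h : IsLift π φ ψ) (hφ : φ.Simple) (hlo : 0 < lo)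
    (hlh : lo ≤ hi) (hl : ∀ v, lo ≤ #(fiber π v)) (hh : ∀ v, #(fiber π v) ≤ hi) :
    ψ.val ≤ (hi / lo) ^ k * φ.val := by
  classical
  have := Fintype.ofFinite V
  have hhi := hlo.trans_le hlh
  refine val_le fun σ => ?_
  by_cases hφ₀ : φ.clauses = []
  · have h₁ : φ.val = 1 := le_antisymm φ.val_le_one
      ((valAt_of_clauses_eq_nil hφ₀ fun _ => false).symm.le.trans (φ.valAt_le_val _))
    rw [valAt_of_clauses_eq_nil (h.clauses_eq_nil hφ₀), h₁, mul_one]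
    exact one_le_pow₀ ((one_le_div hlo).2 hlh)
  have hψ₀ := h.clauses_ne_nil hφ hφ₀ hlo hl
  have hm : 0 < (#φ.clauses.toFinset : ℝ) := by
    rw [List.toFinset_card_of_nodup hφ]
    exact_mod_cast List.length_pos_iff.2 hφ₀
  have hm' : 0 < (#ψ.clauses.toFinset : ℝ) := by
    rw [List.toFinset_card_of_nodup h.simple]
    exact_mod_cast List.length_pos_iff.2 hψ₀
  have hlen := h.pow_mul_length_le hφ hlo.le hl
  rw [← List.toFinset_card_of_nodup hφ, ← List.toFinset_card_of_nodup h.simple] at hlen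
  have hval := φ.val_nonneg
  have hT : 0 < (#(sections π) : ℝ) := by
    rw [sections, Fintype.card_piFinset, Nat.cast_prod]
    exact prod_pos fun v _ => hlo.trans_le (hl v)
  have hsat : ∀ J : V → U, (#{D ∈ φ.clauses.toFinset | D.sat (σ ∘ J)} : ℝ) ≤
      #φ.clauses.toFinset * φ.val := by
    intro J
    have := φ.valAt_le_val (σ ∘ J)
    rwa [valAt_eq_card_div_card hφ hφ₀, div_le_iff₀' hm] at this
  -- Double counting of pairs of a section `J` and a clause satisfied by `σ ∘ J`: by clauses,
  -- `card_sections_filter` gives the satisfied lifts; by sections, `hsat` bounds each contribution.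
  have hcard : (#{C ∈ ψ.clauses.toFinset | C.sat σ} : ℝ) ≤
      hi ^ k * (#φ.clauses.toFinset * φ.val) := by
    refine le_of_mul_le_mul_right ?_ hT
    have e := h.card_filter fun f u => f fun i => σ (u i)
    have e' : #{C ∈ ψ.clauses.toFinset | C.sat σ} = _ := e
    rw [e', Nat.cast_sum, sum_mul]
    calc ∑ D ∈ φ.clauses.toFinset,
          (#{u ∈ lifts π D | D.pred fun i => σ (u i)} : ℝ) * #(sections π)
        = ∑ D ∈ φ.clauses.toFinset,
          (#{J ∈ sections π | D.sat (σ ∘ J)} : ℝ) * #(lifts π D) := by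
          refine sum_congr rfl fun D _ => ?_
          exact_mod_cast (card_sections_filter π D fun u => D.pred fun i => σ (u i)).symm
      _ ≤ ∑ D ∈ φ.clauses.toFinset, (#{J ∈ sections π | D.sat (σ ∘ J)} : ℝ) * hi ^ k := by
          gcongr with D
          exact card_lifts_le_pow hh D
      _ = hi ^ k * ∑ J ∈ sections π, (#{D ∈ φ.clauses.toFinset | D.sat (σ ∘ J)} : ℝ) := by
          rw [← sum_mul, mul_comm]
          congr 1
          simp only [Finset.card_filter, Nat.cast_sum]
          exact sum_comm
      _ ≤ hi ^ k * ∑ J ∈ sections π, #φ.clauses.toFinset * φ.val := by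
          gcongr with J
          exact hsat J
      _ = hi ^ k * (#φ.clauses.toFinset * φ.val) * #(sections π) := by
          rw [sum_const, nsmul_eq_mul]
          ring
  rw [valAt_eq_card_div_card h.simple hψ₀, div_le_iff₀ hm', div_pow, div_mul_eq_mul_div,
    div_mul_eq_mul_div, le_div_iff₀ (by positivity)]
  calc (#{C ∈ ψ.clauses.toFinset | C.sat σ} : ℝ) * lo ^ k
      ≤ hi ^ k * (#φ.clauses.toFinset * φ.val) * lo ^ k := by gcongr
    _ = hi ^ k * φ.val * (lo ^ k * #φ.clauses.toFinset) := by ring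
    _ ≤ hi ^ k * φ.val * #ψ.clauses.toFinset := by gcongr

end Counting

end CSPFormula

/-! ### Percolated lifts and nearly equal fibers. -/

namespace CSPFormula

open Finset

variable {k : ℕ} {U V : Type*}

theorem mem_induce {ψ : CSPFormula k U} {S : Set U} {C : CSPClause k S} :
    C ∈ (ψ.induce S).clauses ↔ ∃ D ∈ ψ.clauses, C.pred = D.pred ∧ ∀ i, (C.vars i : U) = D.vars i := by
  simp only [induce, List.mem_filterMap]
  refine exists_congr fun D => and_congr_right fun _ => ?_
  unfold CSPClause.restrict
  split_ifs with h
  · rw [Option.some.injEq]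
    constructor
    · rintro rfl
      exact ⟨rfl, fun i => rfl⟩
    · rintro ⟨h₁, h₂⟩
      ext1
      · exact h₁.symm
      · ext i
        exact (h₂ i).symm
  · simp only [false_iff, not_and]
    intro _ h₂
    exact h fun i => h₂ i ▸ (C.vars i).2

theorem Simple.induce {ψ : CSPFormula k U} (hψ : ψ.Simple) (S : Set U) : (ψ.induce S).Simple := by
  refine List.Nodup.filterMap (fun C C' D hC hC' => ?_) hψ
  unfold CSPClause.restrict at hC hC'
  split_ifs at hC with h
  · split_ifs at hC' with h'
    · rw [Option.mem_some_iff] at hC hC'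
      rw [← hC'] at hC
      ext1
      · exact congrArg (fun D : CSPClause k S => D.pred) hC
      · ext i
        exact congrArg (fun D : CSPClause k S => (D.vars i : U)) hC
    · simp at hC'
  · simp at hC

/-- Being a lift survives the deletion of variables; only the fibers shrink. So percolation affects
the value bounds only through the fiber sizes. -/
theorem IsLift.induce {π : U → V} {φ : CSPFormula k V} {ψ : CSPFormula k U} (h : IsLift π φ ψ)
    (S : Set U) : IsLift (fun s : S => π s) φ (ψ.induce S) := by
  refine ⟨h.simple.induce S, fun C => ?_⟩
  let C' : CSPClause k U := ⟨C.pred, C.vars.trans (Function.Embedding.subtype _)⟩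
  have hC : C ∈ (ψ.induce S).clauses ↔ C' ∈ ψ.clauses := by
    rw [mem_induce]
    constructor
    · rintro ⟨D, hD, h₁, h₂⟩
      have : C' = D := by
        ext1
        · exact h₁
        · ext i
          exact h₂ i
      exact this ▸ hD
    · exact fun h => ⟨C', h, rfl, fun i => rfl⟩
  rw [hC, h.mem_iff]
  rfl

theorem card_fiber_induce [Fintype U] [DecidableEq V] (π : U → V) (S : Set U) [Fintype S]
    [DecidablePred (· ∈ S)] (v : V) :
    #(fiber (fun s : S => π s) v) = #{u ∈ fiber π v | u ∈ S} := by
  rw [← Finset.card_map (Function.Embedding.subtype (· ∈ S))]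
  congr 1
  ext u
  simp only [fiber, mem_map, mem_filter, mem_univ, true_and, Function.Embedding.subtype_apply]
  constructor
  · rintro ⟨s, hs, rfl⟩
    exact ⟨hs, s.2⟩
  · rintro ⟨h₁, h₂⟩
    exact ⟨⟨u, h₂⟩, h₁, rfl⟩

/-- If the numbers of variables of the lift over the variables of the formula differ by at most a
fraction `γ` from their expectation, the value of the lift is close to that of the formula. -/
theorem IsLift.abs_val_sub_lt [Fintype U] [Finite V] [DecidableEq V] {π : U → V}
    {φ : CSPFormula k V} {ψ : CSPFormula k U} (h : IsLift π φ ψ) (hφ : φ.Simple) {γ ε c : ℝ}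
    (hγ : 0 ≤ γ) (hγ₁ : γ < 1) (hε : ((1 + γ) / (1 - γ)) ^ k < 1 + ε) (hc : 0 < c)
    (hs : ∀ v, |(#(fiber π v) : ℝ) - c| ≤ γ * c) : |ψ.val - φ.val| < ε := by
  have h₁ : ∀ v, (1 - γ) * c ≤ #(fiber π v) := fun v => by
    have := (abs_le.1 (hs v)).1
    linarith
  have h₂ : ∀ v, #(fiber π v) ≤ (1 + γ) * c := fun v => by
    have := (abs_le.1 (hs v)).2
    linarith
  have hγ' : 0 < 1 - γ := by linarith
  have hlo : 0 < (1 - γ) * c := by positivity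
  have hlh : (1 - γ) * c ≤ (1 + γ) * c := by
    gcongr
    linarith
  have hu := h.val_le_mul_val hφ hlo hlh h₁ h₂
  have hl := h.mul_val_le_val hφ hlo hlh h₁ h₂
  rw [mul_div_mul_right _ _ hc.ne'] at hu hl
  set ρ : ℝ := ((1 + γ) / (1 - γ)) ^ k with hρ
  have hρ₁ : 1 ≤ ρ := one_le_pow₀ ((one_le_div hγ').2 (by linarith))
  have e : ((1 - γ) / (1 + γ)) ^ k = ρ⁻¹ := by rw [hρ, ← inv_pow, inv_div]
  rw [e] at hl
  have hv₀ := φ.val_nonneg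
  have hv₁ := φ.val_le_one
  have hρ₂ : φ.val ≤ ρ * ψ.val := by
    rw [inv_mul_le_iff₀ (by linarith)] at hl
    exact hl
  have hw₁ := ψ.val_le_one
  rw [abs_lt]
  -- Both differences are at most `(ρ - 1)` times a value in `[0, 1]`, and `ρ - 1 < ε`.
  constructor <;> nlinarith

theorem IsLift.val_eq_val [Fintype U] [Finite V] [DecidableEq V] {π : U → V}
    {φ : CSPFormula k V} {ψ : CSPFormula k U} (h : IsLift π φ ψ) (hφ : φ.Simple) {R : ℕ}
    (hR : 0 < R) (hs : ∀ v, #(fiber π v) = R) : ψ.val = φ.val := by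
  have hR' : (0 : ℝ) < R := by exact_mod_cast hR
  have hu := h.val_le_mul_val hφ hR' le_rfl (fun v => by rw [hs]) (fun v => by rw [hs])
  have hl := h.mul_val_le_val hφ hR' le_rfl (fun v => by rw [hs]) (fun v => by rw [hs])
  rw [div_self hR'.ne', one_pow, one_mul] at hu hl
  exact le_antisymm hu hl

end CSPFormula

namespace CSPInstance

open CSPFormula Finset

theorem IsBlowup.exists_isLift {k R : ℕ} {Φ Ψ : CSPInstance k} (h : IsBlowup R Φ Ψ)
    (hΨ : Ψ.formula.Simple) : ∃ π : Fin Ψ.numVars → Fin Φ.numVars,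
      IsLift π Φ.formula Ψ.formula ∧ ∀ v, #(fiber π v) = R := by
  obtain ⟨e, he⟩ := h
  refine ⟨fun u => (e.symm u).1, ⟨hΨ, fun C => ?_⟩, fun v => ?_⟩
  · rw [he]
    refine exists_congr fun D => and_congr_right fun _ => ?_
    constructor
    · rintro ⟨j, h₁, h₂⟩
      exact ⟨h₁, fun i => by rw [h₂, Equiv.symm_apply_apply]⟩
    · rintro ⟨h₁, h₂⟩
      exact ⟨fun i => (e.symm (C.vars i)).2, h₁, fun i => by
        rw [← h₂, Prod.mk.eta, Equiv.apply_symm_apply]⟩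
  · have hf : fiber (fun u => (e.symm u).1) v =
        ((univ : Finset (Fin R)).map (Function.Embedding.sectR v _)).map e.toEmbedding := by
      ext u
      simp only [fiber, mem_filter, mem_univ, true_and, mem_map, Equiv.coe_toEmbedding,
        Function.Embedding.sectR_apply, exists_exists_eq_and]
      constructor
      · rintro rfl
        exact ⟨(e.symm u).2, by simp⟩
      · rintro ⟨j, rfl⟩
        simp
    rw [hf, card_map, card_map, card_univ, Fintype.card_fin]

end CSPInstance

/-! ### Concentration of the number of surviving copies. -/

section Percolation

open MeasureTheory ProbabilityTheory Finset unitInterval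

variable {U : Type*}

/-- Chebyshev's inequality for the number of elements of `A` that survive. -/
theorem setBernoulli_real_abs_card_sub_ge_le (p : unitInterval) (A : Finset U) {c : ℝ}
    (hc : 0 < c) :
    (setBernoulli (Set.univ : Set U) p).real
      {S | open scoped Classical in c ≤ |(#{u ∈ A | u ∈ S} : ℝ) - p * #A|} ≤ p * #A / c ^ 2 := by
  classical
  -- The law of the event that `u` survives; `setBernoulli` comes from the product of these laws.
  let ν : U → Measure Prop := fun u =>
    toNNReal p • Measure.dirac (u ∈ Set.univ) + toNNReal (σ p) • Measure.dirac False
  have hν : ∀ u, IsProbabilityMeasure (ν u) := fun u => by infer_instance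
  let μ := Measure.infinitePi ν
  let g : Prop → ℝ := fun q => if q then 1 else 0
  let Y : U → (U → Prop) → ℝ := fun u ω => g (ω u)
  have hg : Measurable g := measurable_of_countable g
  have hmp := fun u => measurePreserving_eval_infinitePi ν u
  have hgν : ∀ u, ∫ q, g q ∂(ν u) = p := fun u => by
    have hi : ∀ q : Prop, Integrable g (Measure.dirac q) := fun q => integrable_dirac (by simp)
    rw [integral_add_measure ((hi _).smul_measure_nnreal) ((hi _).smul_measure_nnreal),
      integral_smul_nnreal_measure, integral_smul_nnreal_measure, integral_dirac, integral_dirac]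
    simp [g, NNReal.smul_def]
  have hY : ∀ u, Measurable (Y u) := fun u => hg.comp (measurable_pi_apply u)
  have hY₂ : ∀ u, MemLp (Y u) 2 μ := fun u => MemLp.of_bound (hY u).aestronglyMeasurable 1
    (.of_forall fun ω => by
      simp only [Y, g]
      split_ifs <;> simp)
  have hEY : ∀ u, ∫ ω, Y u ω ∂μ = p := fun u => by
    rw [← hgν u, ← (hmp u).map_eq, integral_map (hmp u).aemeasurable hg.aestronglyMeasurable]
  -- An indicator equals its square, so its second moment is its mean `p`.
  have hVar : ∀ u, Var[Y u; μ] ≤ p := fun u => by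
    refine (variance_le_expectation_sq (hY u).aestronglyMeasurable).trans (le_of_eq ?_)
    rw [← hEY u]
    congr 1
    funext ω
    simp only [Y, g, Pi.pow_apply]
    split_ifs <;> simp
  have hind : iIndepFun Y μ := iIndepFun_infinitePi (X := fun _ => g) fun _ => hg
  let X : (U → Prop) → ℝ := ∑ u ∈ A, Y u
  have hX₂ : MemLp X 2 μ := memLp_finsetSum' _ fun u _ => hY₂ u
  have hEX : ∫ ω, X ω ∂μ = p * #A := by
    simp only [X, Finset.sum_apply]
    rw [integral_finsetSum _ fun u _ => (hY₂ u).integrable one_le_two]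
    simp [hEY, mul_comm]
  have hVX : Var[X; μ] ≤ p * #A := by
    rw [IndepFun.variance_sum (fun u _ => hY₂ u) fun u _ u' _ huu => hind.indepFun huu]
    refine (sum_le_sum fun u _ => hVar u).trans (le_of_eq ?_)
    simp [mul_comm]
  have hXS : ∀ ω : U → Prop, (#{u ∈ A | u ∈ {u | ω u}} : ℝ) = X ω := fun ω => by
    simp only [X, Y, g, Finset.sum_apply, Set.mem_ofPred_eq]
    rw [Finset.card_filter, Nat.cast_sum]
    exact sum_congr rfl fun u _ => by split_ifs <;> simp
  have hcheb := meas_ge_le_variance_div_sq hX₂ hc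
  rw [hEX] at hcheb
  have hset : (fun q : U → Prop => {u | q u}) ⁻¹'
      {S | open scoped Classical in c ≤ |(#{u ∈ A | u ∈ S} : ℝ) - p * #A|} =
      {ω | c ≤ |X ω - p * #A|} := by
    ext ω
    simp only [Set.mem_preimage, Set.mem_ofPred_eq]
    rw [← hXS ω]
    simp only [Set.mem_ofPred_eq]
  rw [measureReal_def, setBernoulli_apply', hset]
  refine ENNReal.toReal_le_of_le_ofReal (by have := p.2.1; positivity) (hcheb.trans ?_)
  apply ENNReal.ofReal_le_ofReal
  gcongr

end Percolation

/-! ### The value of a percolated blowup. -/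

section PercolatedValue

open MeasureTheory ProbabilityTheory Filter Finset

/-- The left side is continuous in `γ` at `0`, where it equals `1`. -/
theorem exists_pow_ratio_lt (k : ℕ) {ε : ℝ} (hε : 0 < ε) :
    ∃ γ : ℝ, 0 < γ ∧ γ < 1 ∧ ((1 + γ) / (1 - γ)) ^ k < 1 + ε := by
  have hc : ContinuousAt (fun γ : ℝ => ((1 + γ) / (1 - γ)) ^ k) 0 := by
    refine ((continuousAt_const.add continuousAt_id).div
      (continuousAt_const.sub continuousAt_id) ?_).pow k
    simp
  have h₁ : ∀ᶠ γ : ℝ in nhds 0, ((1 + γ) / (1 - γ)) ^ k < 1 + ε :=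
    hc.eventually_lt_const (by simpa using hε)
  have h₂ : ∀ᶠ γ : ℝ in nhds 0, γ < 1 := eventually_lt_nhds one_pos
  have h₃ : ∀ᶠ γ : ℝ in nhdsWithin 0 (Set.Ioi 0), 0 < γ := eventually_mem_nhdsWithin
  obtain ⟨γ, h₃, h₂, h₁⟩ := (h₃.and ((h₂.and h₁).filter_mono nhdsWithin_le_nhds)).exists
  exact ⟨γ, h₃, h₂, h₁⟩

namespace CSPInstance

open CSPFormula

variable {k : ℕ}

/-- A blowup keeps the value of a satisfiable formula under variable percolation. -/
theorem IsBlowup.varPercolation_val_eq_one {R : ℕ} {Φ Ψ : CSPInstance k} (h : IsBlowup R Φ Ψ)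
    (hΨ : Ψ.formula.Simple) (hval : Φ.formula.val = 1) (p : unitInterval) :
    Ψ.varPercolation p {S | (Ψ.formula.induce S).val = 1} = 1 := by
  obtain ⟨π, hπ, -⟩ := h.exists_isLift hΨ
  rw [show {S | (Ψ.formula.induce S).val = 1} = Set.univ from
    Set.eq_univ_of_forall fun S => (hπ.induce S).val_eq_one hval]
  unfold varPercolation
  exact measure_univ

/-- The probability that variable percolation changes the value of a blowup is small if the
expected number of surviving copies of a variable is large. -/
theorem IsBlowup.le_varPercolation_real {R : ℕ} {Φ Ψ : CSPInstance k} (h : IsBlowup R Φ Ψ)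
    (hΦ : Φ.formula.Simple) (hΨ : Ψ.formula.Simple) {γ ε : ℝ} (hγ : 0 < γ) (hγ₁ : γ < 1)
    (hε : ((1 + γ) / (1 - γ)) ^ k < 1 + ε) (p : unitInterval) (hpR : 0 < (p : ℝ) * R) :
    1 - Φ.numVars / (γ ^ 2 * (p * R)) ≤
      (Ψ.varPercolation p).real {S | |(Ψ.formula.induce S).val - Φ.formula.val| < ε} := by
  classical
  obtain ⟨π, hπ, hcard⟩ := h.exists_isLift hΨ
  unfold varPercolation
  set μ := setBernoulli (Set.univ : Set (Fin Ψ.numVars)) p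
  let bad : Fin Φ.numVars → Set (Set (Fin Ψ.numVars)) := fun v =>
    {S | open scoped Classical in
      γ * (p * R) ≤ |(#{u ∈ fiber π v | u ∈ S} : ℝ) - p * #(fiber π v)|}
  -- Chebyshev with deviation `γ * (p * R)` against a variance of at most `p * R`.
  have hbad : ∀ v, μ.real (bad v) ≤ 1 / (γ ^ 2 * (p * R)) := fun v => by
    refine (setBernoulli_real_abs_card_sub_ge_le p (fiber π v) (by positivity)).trans
      (le_of_eq ?_)
    rw [hcard]
    field_simp
  have hsub : (⋃ v ∈ (Finset.univ : Finset (Fin Φ.numVars)), bad v)ᶜ ⊆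
      {S | |(Ψ.formula.induce S).val - Φ.formula.val| < ε} := by
    intro S hS
    simp only [Finset.mem_univ, Set.iUnion_true, Set.mem_compl_iff, Set.mem_iUnion, not_exists]
      at hS
    refine (hπ.induce S).abs_val_sub_lt hΦ hγ.le hγ₁ hε hpR fun v => ?_
    rw [card_fiber_induce]
    have := hS v
    simp only [bad, Set.mem_ofPred_eq, not_le, hcard] at this
    convert this.le
  refine le_trans ?_ (measureReal_mono hsub)
  rw [probReal_compl_eq_one_sub .of_discrete]
  have hle := (measureReal_biUnion_finset_le (μ := μ) Finset.univ bad).trans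
    (sum_le_sum fun v _ => hbad v)
  rw [sum_const, card_univ, Fintype.card_fin, nsmul_eq_mul, mul_one_div] at hle
  linarith

end CSPInstance

end PercolatedValue

/-! ### Choice of the parameters and conclusion. -/

/-- Bound on the expected number of surviving copies of a variable. -/
theorem sq_le_mul_pow_of_lt {N m : ℕ} {δ p : ℝ} (hN : 0 < N) (hm : 3 ≤ (m + 1) * δ) (hp : p ≤ 1)
    (h : 1 / ((N * (N + 1) ^ m : ℕ) : ℝ) ^ (1 - δ) < p) :
    ((N : ℝ) + 1) ^ 2 ≤ p * (N + 1) ^ m := by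
  have hN' : (1 : ℝ) ≤ N := by exact_mod_cast hN
  set n : ℝ := ((N * (N + 1) ^ m : ℕ) : ℝ) with hn
  have hn₁ : 1 ≤ n := by
    rw [hn]
    exact_mod_cast Nat.mul_pos hN (by positivity)
  -- For `δ ≥ 1` the lower bound on `p` would be at least `1`.
  have hδ : δ < 1 := by
    by_contra hδ
    have : n ^ (1 - δ) ≤ 1 := Real.rpow_le_one_of_one_le_of_nonpos hn₁ (by linarith)
    have : 1 ≤ 1 / n ^ (1 - δ) := (one_le_div (Real.rpow_pos_of_pos (by linarith) _)).2 this
    linarith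
  have hnle : n ≤ ((N : ℝ) + 1) ^ ((m : ℝ) + 1) := by
    rw [hn, show (m : ℝ) + 1 = ((m + 1 : ℕ) : ℝ) by push_cast; ring, Real.rpow_natCast, pow_succ']
    push_cast
    gcongr
    linarith
  have hpow : n ^ (1 - δ) ≤ ((N : ℝ) + 1) ^ (((m : ℝ) + 1) * (1 - δ)) := by
    rw [Real.rpow_mul (by positivity)]
    exact Real.rpow_le_rpow (by linarith) hnle (by linarith)
  have hpos : 0 < n ^ (1 - δ) := Real.rpow_pos_of_pos (by linarith) _
  have hp' : (((N : ℝ) + 1) ^ (((m : ℝ) + 1) * (1 - δ)))⁻¹ ≤ p := by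
    refine le_trans ?_ h.le
    rw [one_div]
    exact inv_anti₀ hpos hpow
  calc ((N : ℝ) + 1) ^ 2 = ((N : ℝ) + 1) ^ (2 : ℝ) := by norm_cast
    -- The exponent on the right is `(m + 1) * δ - 1`, which is at least `2` by `hm`.
    _ ≤ ((N : ℝ) + 1) ^ (-(((m : ℝ) + 1) * (1 - δ)) + m) :=
        Real.rpow_le_rpow_of_exponent_le (by linarith) (by nlinarith)
    _ = (((N : ℝ) + 1) ^ (((m : ℝ) + 1) * (1 - δ)))⁻¹ * (N + 1) ^ m := by
        rw [Real.rpow_add (by positivity), Real.rpow_neg (by positivity), Real.rpow_natCast]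
    _ ≤ p * (N + 1) ^ m := by gcongr

/-- Since `n + 1 ≤ (N + 1) ^ (m + 1)`, an error of order `1 / (N + 1)` is bounded in terms of `n`
alone. -/
theorem inv_le_rpow_neg_inv (N m : ℕ) :
    ((N : ℝ) + 1)⁻¹ ≤ (((N * (N + 1) ^ m : ℕ) : ℝ) + 1) ^ (-((m : ℝ) + 1)⁻¹) := by
  rw [Real.rpow_neg (by positivity)]
  refine inv_anti₀ (by positivity) ?_
  rw [Real.rpow_inv_le_iff_of_pos (by positivity) (by positivity) (by positivity),
    show (m : ℝ) + 1 = ((m + 1 : ℕ) : ℝ) by push_cast; ring, Real.rpow_natCast]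
  have : N * (N + 1) ^ m + 1 ≤ (N + 1) ^ (m + 1) := by
    rw [pow_succ', add_mul]
    have := Nat.one_le_pow m (N + 1) (by omega)
    omega
  exact_mod_cast this

theorem mainTheorem8 (k : ℕ) (ε δ : ℝ) (hε : 0 < ε) (hδ : 0 < δ) :
    ∃ (f : CSPInstance k → CSPInstance k) (R : ℕ → ℕ) (η : ℕ → ℝ),
      CSPInstance.PolyTimeReduction f ∧
      (∀ N, 0 < R N) ∧
      Filter.Tendsto η Filter.atTop (nhds 0) ∧
      ∀ Φ : CSPInstance k, Φ.formula.Simple →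
        CSPInstance.IsBlowup (R Φ.numVars) Φ (f Φ) ∧
        (f Φ).formula.Simple ∧
        (f Φ).formula.preds = Φ.formula.preds ∧
        (f Φ).formula.val = Φ.formula.val ∧
        ∀ p : unitInterval, 1 / ((f Φ).numVars : ℝ) ^ (1 - δ) < (p : ℝ) →
          (Φ.formula.val = 1 →
            (f Φ).varPercolation p {S | ((f Φ).formula.induce S).val = 1} = 1) ∧
          (Φ.formula.val < 1 →
            1 - η (f Φ).numVars ≤
              ((f Φ).varPercolation p).real
                {S | |((f Φ).formula.induce S).val - Φ.formula.val| < ε}) := by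
  obtain ⟨γ, hγ, hγ₁, hγε⟩ := exists_pow_ratio_lt k hε
  obtain ⟨m, hm⟩ := exists_nat_ge (3 / δ)
  have hm' : 3 ≤ ((m : ℝ) + 1) * δ := by
    rw [div_le_iff₀ hδ] at hm
    linarith
  refine ⟨fun Φ => CSPInstance.blowup ((Φ.numVars + 1) ^ m) Φ, fun N => (N + 1) ^ m,
    fun n => (γ ^ 2)⁻¹ * ((n : ℝ) + 1) ^ (-((m : ℝ) + 1)⁻¹),
    CSPInstance.polyTimeReduction_blowup k m, fun N => by positivity, ?_, fun Φ hΦ => ?_⟩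
  · have h := (tendsto_rpow_neg_atTop (y := ((m : ℝ) + 1)⁻¹) (by positivity)).comp
      (Filter.tendsto_atTop_add_const_right Filter.atTop (1 : ℝ) tendsto_natCast_atTop_atTop)
    simpa using h.const_mul (γ ^ 2)⁻¹
  have hB := CSPInstance.isBlowup_blowup ((Φ.numVars + 1) ^ m) Φ
  have hR : 0 < (Φ.numVars + 1) ^ m := by positivity
  have hS := CSPInstance.simple_blowup ((Φ.numVars + 1) ^ m) hΦ
  refine ⟨hB, hS, hB.preds_eq hR, ?_, fun p hp => ⟨fun hval =>
    hB.varPercolation_val_eq_one hS hval p, fun _ => ?_⟩⟩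
  · obtain ⟨π, hπ, hcard⟩ := hB.exists_isLift hS
    exact hπ.val_eq_val hΦ hR hcard
  have hp₀ : 0 < (p : ℝ) := lt_of_le_of_lt (by positivity) hp
  have hpR : 0 < (p : ℝ) * ((Φ.numVars + 1) ^ m : ℕ) := by positivity
  refine le_trans ?_ (hB.le_varPercolation_real hΦ hS hγ hγ₁ hγε p hpR)
  refine sub_le_sub_left ?_ 1
  change _ ≤ (γ ^ 2)⁻¹ * (((Φ.numVars * (Φ.numVars + 1) ^ m : ℕ) : ℝ) + 1) ^ _
  refine le_trans ?_ (mul_le_mul_of_nonneg_left (inv_le_rpow_neg_inv Φ.numVars m) (by positivity))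
  -- Without variables the union bound is empty and the error is `0`. The case is separate because
  -- then `n = 0` and the hypothesis on `p` need not give the lower bound on `p * R`.
  rcases Nat.eq_zero_or_pos Φ.numVars with h₀ | hN
  · rw [h₀]
    simp
    positivity
  have hsq := sq_le_mul_pow_of_lt hN hm' p.2.2 hp
  push_cast
  calc (Φ.numVars : ℝ) / (γ ^ 2 * (p * ((Φ.numVars : ℝ) + 1) ^ m))
      ≤ ((Φ.numVars : ℝ) + 1) / (γ ^ 2 * ((Φ.numVars : ℝ) + 1) ^ 2) := by
        gcongr
        linarith
    _ = (γ ^ 2)⁻¹ * ((Φ.numVars : ℝ) + 1)⁻¹ := by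
        field_simp
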